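/- Let $k$ be a field with pairwise commuting ring endomorphisms $\sigma_1,\dots,\sigma_n$. Let $T$ be the free commutative monoid on the symbols $\sigma_1,\dots,\sigma_n$, whose elements $\tau=\sigma_1^{k_1}\cdots\sigma_n^{k_n}$ act on $k$ as endomorphisms, put $\operatorname{ord}(\tau)=k_1+\dots+k_n$, and let $T[i]=\{\tau\in T : \operatorname{ord}(\tau)\le i\}$ for $i\in\mathbb N=\{0,1,2,\dots\}$. Let $\mathcal G$ be an affine algebraic group of finite type over $k$, with coordinate Hopf algebra $k[\mathcal G]$. For $\tau\in T$ let ${}^\tau\mathcal G$ be the base change of $\mathcal G$ along $\tau\colon k\to k$, and let $\mathcal G[i]=\prod_{\tau\in T[i]}{}^\tau\mathcal G$, so that $k[\mathcal G[i]]=\bigotimes_{\tau\in T[i]}\bigl(k[\mathcal G]\otimes_{k,\tau}k\bigr)$. There are natural inclusions $k[\mathcal G[i]]\subseteq k[\mathcal G[i+1]]$, and $\sigma_j$ extends to ring homomorphisms $\sigma_j\colon k[\mathcal G[i]]\to k[\mathcal G[i+1]]$ that map $r\otimes\lambda$ in the factor of index $\tau$ to $r\otimes\sigma_j(\lambda)$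 in the factor of index $\sigma_j\tau$. A generalised $\sigma$-algebraic group with respect to $\mathcal G$ is a sequence $(G[i])_{i\in\mathbb N}$ in which each $G[i]$ is a closed subgroup of $\mathcal G[i]$, defined by a Hopf ideal $\mathbb I(G[i])\subseteq k[\mathcal G[i]]$, and such that $\mathbb I(G[i])\subseteq\mathbb I(G[i+1])$ and $\sigma_j(\mathbb I(G[i]))\subseteq\mathbb I(G[i+1])$ for all $i\in\mathbb N$ and $1\le j\le n$. **Theorem.** Let $(G[i])_{i\in\mathbb N}$ be a generalised $\sigma$-algebraic group with respect to $\mathcal G$. Then there is an $m\in\mathbb N$ such that for all $i\ge m$, as ideals of $k[\mathcal G[i+1]]$, $$\mathbb I(G[i+1])=\bigl(\mathbb I(G[i]),\,\sigma_1(\mathbb I(G[i])),\,\dots,\,\sigma_n(\mathbb I(G[i]))\bigr).$$ -/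

import Mathlib

open scoped TensorProduct

noncomputable section

/-! ### Finite tensor products of commutative Hopf algebras -/

namespace PiTensorProduct

section Restriction

variable {R B C : Type*} [CommRing R] [CommRing B] [CommRing C] [Algebra R C]

theorem coassoc_of_comp [Bialgebra R B] (s : B →ₐ[R] C) (c : C →ₐ[R] C ⊗[R] C)
    (h : c.comp s = (Algebra.TensorProduct.map s s).comp (Bialgebra.comulAlgHom R B)) :
    ((Algebra.TensorProduct.assoc R R R C C C).toAlgHom.comp
      ((Algebra.TensorProduct.map c (.id R C)).comp c)).comp s =
      ((Algebra.TensorProduct.map (.id R C) c).comp c).comp s := by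
  have h' (x : B) : c (s x) = Algebra.TensorProduct.map s s (Coalgebra.comul x) :=
    DFunLike.congr_fun h x
  have h1 (t : B ⊗[R] B) : Algebra.TensorProduct.assoc R R R C C C
      (Algebra.TensorProduct.map c (.id R C) (Algebra.TensorProduct.map s s t)) =
      Algebra.TensorProduct.map s (Algebra.TensorProduct.map s s)
        (TensorProduct.assoc R B B B (Coalgebra.comul.rTensor B t)) := by
    induction t with
    | zero => simp
    | add x y hx hy => simp only [map_add, hx, hy]
    | tmul x y =>
      simp only [Algebra.TensorProduct.map_tmul, h', AlgHom.id_apply, LinearMap.rTensor_tmul]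
      induction (Coalgebra.comul (R := R) x) with
      | zero => simp
      | add x y hx hy => simp only [map_add, TensorProduct.add_tmul, hx, hy]
      | tmul x z => simp
  have h2 (t : B ⊗[R] B) :
      Algebra.TensorProduct.map (.id R C) c (Algebra.TensorProduct.map s s t) =
      Algebra.TensorProduct.map s (Algebra.TensorProduct.map s s)
        (Coalgebra.comul.lTensor B t) := by
    induction t with
    | zero => simp
    | add x y hx hy => simp only [map_add, hx, hy]
    | tmul x y => simp [h']
  ext x
  change Algebra.TensorProduct.assoc R R R C C C
    (Algebra.TensorProduct.map c (.id R C) (c (s x))) =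
    Algebra.TensorProduct.map (.id R C) c (c (s x))
  rw [h', h1, h2, Coalgebra.coassoc_apply]

theorem rTensor_of_comp [Bialgebra R B] (s : B →ₐ[R] C) (c : C →ₐ[R] C ⊗[R] C)
    (e : C →ₐ[R] R)
    (h : c.comp s = (Algebra.TensorProduct.map s s).comp (Bialgebra.comulAlgHom R B))
    (he : e.comp s = Bialgebra.counitAlgHom R B) :
    ((Algebra.TensorProduct.map e (.id R C)).comp c).comp s =
      (Algebra.TensorProduct.lid R C).symm.toAlgHom.comp s := by
  have h' (x : B) : c (s x) = Algebra.TensorProduct.map s s (Coalgebra.comul x) :=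
    DFunLike.congr_fun h x
  have he' (x : B) : e (s x) = Coalgebra.counit x := DFunLike.congr_fun he x
  have h1 (t : B ⊗[R] B) :
      Algebra.TensorProduct.map e (.id R C) (Algebra.TensorProduct.map s s t) =
      Algebra.TensorProduct.map (.id R R) s (Coalgebra.counit.rTensor B t) := by
    induction t with
    | zero => simp
    | add x y hx hy => simp only [map_add, hx, hy]
    | tmul x y => simp [he']
  ext x
  change Algebra.TensorProduct.map e (.id R C) (c (s x)) = 1 ⊗ₜ s x
  rw [h', h1, Coalgebra.rTensor_counit_comul]
  simp

theorem lTensor_of_comp [Bialgebra R B] (s : B →ₐ[R] C) (c : C →ₐ[R] C ⊗[R] C)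
    (e : C →ₐ[R] R)
    (h : c.comp s = (Algebra.TensorProduct.map s s).comp (Bialgebra.comulAlgHom R B))
    (he : e.comp s = Bialgebra.counitAlgHom R B) :
    ((Algebra.TensorProduct.map (.id R C) e).comp c).comp s =
      (Algebra.TensorProduct.rid R R C).symm.toAlgHom.comp s := by
  have h' (x : B) : c (s x) = Algebra.TensorProduct.map s s (Coalgebra.comul x) :=
    DFunLike.congr_fun h x
  have he' (x : B) : e (s x) = Coalgebra.counit x := DFunLike.congr_fun he x
  have h1 (t : B ⊗[R] B) :
      Algebra.TensorProduct.map (.id R C) e (Algebra.TensorProduct.map s s t) =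
      Algebra.TensorProduct.map s (.id R R) (Coalgebra.counit.lTensor B t) := by
    induction t with
    | zero => simp
    | add x y hx hy => simp only [map_add, hx, hy]
    | tmul x y => simp [he']
  ext x
  change Algebra.TensorProduct.map (.id R C) e (c (s x)) = s x ⊗ₜ 1
  rw [h', h1, Coalgebra.lTensor_counit_comul]
  simp

theorem antipode_left_of_comp [HopfAlgebra R B] (s : B →ₐ[R] C) (c : C →ₐ[R] C ⊗[R] C)
    (e : C →ₐ[R] R) (a : C →ₐ[R] C)
    (h : c.comp s = (Algebra.TensorProduct.map s s).comp (Bialgebra.comulAlgHom R B))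
    (he : e.comp s = Bialgebra.counitAlgHom R B)
    (ha : a.comp s = s.comp (HopfAlgebra.antipodeAlgHom R B)) :
    ((Algebra.TensorProduct.lift a (.id R C) fun _ ↦ Commute.all _).comp c).comp s =
      ((Algebra.ofId R C).comp e).comp s := by
  have h' (x : B) : c (s x) = Algebra.TensorProduct.map s s (Coalgebra.comul x) :=
    DFunLike.congr_fun h x
  have he' (x : B) : e (s x) = Coalgebra.counit x := DFunLike.congr_fun he x
  have ha' (x : B) : a (s x) = s (HopfAlgebra.antipode R x) := DFunLike.congr_fun ha x
  have h1 (t : B ⊗[R] B) :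
      Algebra.TensorProduct.lift a (.id R C) (fun _ _ ↦ Commute.all _ _)
        (Algebra.TensorProduct.map s s t) =
      s (LinearMap.mul' R B ((HopfAlgebra.antipode R).rTensor B t)) := by
    induction t with
    | zero => simp
    | add x y hx hy => simp only [map_add, hx, hy]
    | tmul x y =>
      rw [Algebra.TensorProduct.map_tmul, Algebra.TensorProduct.lift_tmul, ha']
      simp
  ext x
  change Algebra.TensorProduct.lift a (.id R C) (fun _ _ ↦ Commute.all _ _) (c (s x)) =
    algebraMap R C (e (s x))
  rw [h', h1, he', HopfAlgebra.mul_antipode_rTensor_comul_apply, AlgHom.commutes]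

theorem antipode_right_of_comp [HopfAlgebra R B] (s : B →ₐ[R] C) (c : C →ₐ[R] C ⊗[R] C)
    (e : C →ₐ[R] R) (a : C →ₐ[R] C)
    (h : c.comp s = (Algebra.TensorProduct.map s s).comp (Bialgebra.comulAlgHom R B))
    (he : e.comp s = Bialgebra.counitAlgHom R B)
    (ha : a.comp s = s.comp (HopfAlgebra.antipodeAlgHom R B)) :
    ((Algebra.TensorProduct.lift (.id R C) a fun _ _ ↦ Commute.all _ _).comp c).comp s =
      ((Algebra.ofId R C).comp e).comp s := by
  have h' (x : B) : c (s x) = Algebra.TensorProduct.map s s (Coalgebra.comul x) :=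
    DFunLike.congr_fun h x
  have he' (x : B) : e (s x) = Coalgebra.counit x := DFunLike.congr_fun he x
  have ha' (x : B) : a (s x) = s (HopfAlgebra.antipode R x) := DFunLike.congr_fun ha x
  have h1 (t : B ⊗[R] B) :
      Algebra.TensorProduct.lift (.id R C) a (fun _ _ ↦ Commute.all _ _)
        (Algebra.TensorProduct.map s s t) =
      s (LinearMap.mul' R B ((HopfAlgebra.antipode R).lTensor B t)) := by
    induction t with
    | zero => simp
    | add x y hx hy => simp only [map_add, hx, hy]
    | tmul x y => simp [ha']
  ext x
  change Algebra.TensorProduct.lift (.id R C) a (fun _ _ ↦ Commute.all _ _) (c (s x)) =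
    algebraMap R C (e (s x))
  rw [h', h1, he', HopfAlgebra.mul_antipode_lTensor_comul_apply, AlgHom.commutes]

end Restriction

variable {ι R S : Type*} {A : ι → Type*} [Fintype ι] [CommRing R]
  [∀ i, CommRing (A i)]

/-- The tensor product of finitely many commutative algebras is their coproduct: the algebra
homomorphism out of it with prescribed restrictions to the factors. -/
def coprodLift [∀ i, Algebra R (A i)] [CommRing S] [Algebra R S] (f : ∀ i, A i →ₐ[R] S) :
    (⨂[R] i, A i) →ₐ[R] S :=
  liftAlgHom ((MultilinearMap.mkPiAlgebra R ι S).compLinearMap fun i => (f i).toLinearMap)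
    (by simp)
    (fun x y => by
      rw [MultilinearMap.compLinearMap_apply, MultilinearMap.compLinearMap_apply,
        MultilinearMap.compLinearMap_apply]
      simp [Finset.prod_mul_distrib])

theorem coprodLift_tprod [∀ i, Algebra R (A i)] [CommRing S] [Algebra R S]
    (f : ∀ i, A i →ₐ[R] S) (x : ∀ i, A i) :
    coprodLift f (tprod R x) = ∏ i, f i (x i) :=
  (lift.tprod x).trans rfl

variable [DecidableEq ι]

@[simp]
theorem coprodLift_comp_single [∀ i, Algebra R (A i)] [CommRing S] [Algebra R S]
    (f : ∀ i, A i →ₐ[R] S) (i : ι) : (coprodLift f).comp (singleAlgHom i) = f i := by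
  ext a
  change coprodLift f (tprod R (Pi.mulSingle i a)) = f i a
  rw [coprodLift_tprod, Finset.prod_eq_single i]
  · simp
  · intro j _ hj
    simp [Pi.mulSingle_eq_of_ne hj]
  · simp

@[simp]
theorem coprodLift_single [∀ i, Algebra R (A i)] [CommRing S] [Algebra R S]
    (f : ∀ i, A i →ₐ[R] S) (i : ι) (a : A i) :
    coprodLift f (singleAlgHom (R := R) i a) = f i a :=
  DFunLike.congr_fun (coprodLift_comp_single f i) a

variable [∀ i, HopfAlgebra R (A i)]

/-- The comultiplication of a product of affine group schemes. -/
def hopfComul : (⨂[R] i, A i) →ₐ[R] (⨂[R] i, A i) ⊗[R] (⨂[R] i, A i) :=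
  coprodLift fun i =>
    (Algebra.TensorProduct.map (singleAlgHom i) (singleAlgHom i)).comp
      (Bialgebra.comulAlgHom R (A i))

/-- The counit of a product of affine group schemes. -/
def hopfCounit : (⨂[R] i, A i) →ₐ[R] R :=
  coprodLift fun i => Bialgebra.counitAlgHom R (A i)

/-- The antipode of a product of affine group schemes. -/
def hopfAntipode : (⨂[R] i, A i) →ₐ[R] (⨂[R] i, A i) :=
  coprodLift fun i => (singleAlgHom i).comp (HopfAlgebra.antipodeAlgHom R (A i))

theorem hopfComul_comp_single (i : ι) :
    (hopfComul (R := R) (A := A)).comp (singleAlgHom i) =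
      (Algebra.TensorProduct.map (singleAlgHom i) (singleAlgHom i)).comp
        (Bialgebra.comulAlgHom R (A i)) :=
  coprodLift_comp_single _ i

theorem hopfCounit_comp_single (i : ι) :
    (hopfCounit (R := R) (A := A)).comp (singleAlgHom i) = Bialgebra.counitAlgHom R (A i) :=
  coprodLift_comp_single _ i

theorem hopfAntipode_comp_single (i : ι) :
    (hopfAntipode (R := R) (A := A)).comp (singleAlgHom i) =
      (singleAlgHom i).comp (HopfAlgebra.antipodeAlgHom R (A i)) :=
  coprodLift_comp_single _ i

instance instBialgebraPi : Bialgebra R (⨂[R] i, A i) :=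
  Bialgebra.ofAlgHom hopfComul hopfCounit
    (algHom_ext fun i => coassoc_of_comp _ _ (hopfComul_comp_single i))
    (algHom_ext fun i =>
      rTensor_of_comp _ _ _ (hopfComul_comp_single i) (hopfCounit_comp_single i))
    (algHom_ext fun i =>
      lTensor_of_comp _ _ _ (hopfComul_comp_single i) (hopfCounit_comp_single i))

instance instHopfAlgebraPi : HopfAlgebra R (⨂[R] i, A i) :=
  HopfAlgebra.ofAlgHom hopfAntipode
    (algHom_ext fun i => antipode_left_of_comp _ _ _ _ (hopfComul_comp_single i)
      (hopfCounit_comp_single i) (hopfAntipode_comp_single i))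
    (algHom_ext fun i => antipode_right_of_comp _ _ _ _ (hopfComul_comp_single i)
      (hopfCounit_comp_single i) (hopfAntipode_comp_single i))

end PiTensorProduct

/-! ### Difference fields -/

/-- A difference structure on a commutative ring: `n` pairwise commuting endomorphisms. -/
structure DifferenceStructure (n : ℕ) (k : Type*) [CommRing k] where
  /-- The basic endomorphisms. -/
  endo : Fin n → k →+* k
  comm : ∀ i j, Commute (endo i) (endo j)

namespace DifferenceStructure

variable {n : ℕ} {k : Type*} [CommRing k] (σ : DifferenceStructure n k)

/-- The endomorphism `σ₁ ^ τ₁ ⋯ σₙ ^ τₙ` attached to an exponent vector `τ`. -/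
def transform (τ : Fin n → ℕ) : k →+* k :=
  Finset.univ.noncommProd (fun j => σ.endo j ^ τ j)
    fun i _ j _ _ => (σ.comm i j).pow_pow _ _

theorem transform_add (τ ρ : Fin n → ℕ) :
    σ.transform (τ + ρ) = σ.transform τ * σ.transform ρ := by
  refine Eq.trans (Finset.noncommProd_congr rfl (fun j _ => pow_add _ _ _) _)
    (Finset.noncommProd_mul_distrib (fun j => σ.endo j ^ τ j) (fun j => σ.endo j ^ ρ j) _ _
      fun i _ j _ _ => (σ.comm i j).pow_pow _ _)

theorem transform_single (j : Fin n) : σ.transform (Pi.single j 1) = σ.endo j := by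
  unfold transform
  have h1 : (Finset.univ.erase j).noncommProd
      (fun i => σ.endo i ^ (Pi.single j 1 : Fin n → ℕ) i)
      (fun i _ i' _ _ => (σ.comm i i').pow_pow _ _) = 1 := by
    refine (Finset.noncommProd_eq_pow_card _ _ _ 1 fun i hi => ?_).trans (one_pow _)
    simp [Pi.single_eq_of_ne (Finset.ne_of_mem_erase hi)]
  refine (Finset.mul_noncommProd_erase _ (Finset.mem_univ j) _ _).symm.trans ?_
  rw [h1]
  simp

end DifferenceStructure

/-- Exponent vectors of order at most `i`. -/
abbrev TransformLE (n i : ℕ) : Type := {τ : Fin n → ℕ // ∑ j, τ j ≤ i}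

instance (n i : ℕ) : Finite (TransformLE n i) :=
  Finite.of_injective
    (fun τ : TransformLE n i => fun j : Fin n => (⟨τ.1 j, Nat.lt_succ_of_le
      ((Finset.single_le_sum (f := τ.1) (fun _ _ => Nat.zero_le _) (Finset.mem_univ j)).trans τ.2)⟩
        : Fin (i + 1)))
    (fun _ _ h => Subtype.ext (funext fun j => congrArg Fin.val (congrFun h j)))

instance (n i : ℕ) : Fintype (TransformLE n i) := Fintype.ofFinite _

namespace TransformLE

variable {n i : ℕ}

/-- The inclusion of transforms of order at most `i` in those of order at most `i + 1`. -/
def incl (τ : TransformLE n i) : TransformLE n (i + 1) := ⟨τ.1, τ.2.trans (Nat.le_succ i)⟩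

/-- Multiplication by the `j`-th basic endomorphism. -/
def shift (j : Fin n) (τ : TransformLE n i) : TransformLE n (i + 1) :=
  ⟨Pi.single j 1 + τ.1, by
    have := τ.2
    simp only [Pi.add_apply, Finset.sum_add_distrib, Finset.sum_pi_single', Finset.mem_univ,
      if_true]
    omega⟩

theorem transform_shift {k : Type*} [CommRing k] (σ : DifferenceStructure n k) (j : Fin n)
    (τ : TransformLE n i) :
    σ.transform (τ.shift j).1 = (σ.endo j).comp (σ.transform τ.1) := by
  rw [shift, σ.transform_add, σ.transform_single]
  rfl

end TransformLE

/-! ### Base change along an endomorphism of the base -/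

section BaseChange

variable {k : Type*} [CommRing k]

/-- The ring `k`, regarded as a `k`-algebra through the endomorphism `φ`. -/
@[nolint unusedArguments]
def Twist (_φ : k →+* k) : Type _ := k

instance (φ : k →+* k) : CommRing (Twist φ) := inferInstanceAs (CommRing k)

instance (φ : k →+* k) : Algebra k (Twist φ) := RingHom.toAlgebra (R := k) (S := k) φ

/-- The base change of `A` along `φ : k → k`. It is a `k`-algebra through the factor `k`. -/
def BaseChange (φ : k →+* k) (A : Type*) [CommRing A] [HopfAlgebra k A] : Type _ :=
  Twist φ ⊗[k] A

variable (A : Type*) [CommRing A] [HopfAlgebra k A]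

instance (φ : k →+* k) : CommRing (BaseChange φ A) :=
  inferInstanceAs (CommRing (Twist φ ⊗[k] A))

instance (φ : k →+* k) : HopfAlgebra k (BaseChange φ A) :=
  inferInstanceAs (HopfAlgebra (Twist φ) (Twist φ ⊗[k] A))

/-- For `ψ = θ ∘ φ`, the map `c ⊗ a ↦ θ c ⊗ a` between base changes. -/
def BaseChange.twist {φ ψ : k →+* k} (θ : k →+* k) (h : ψ = θ.comp φ) :
    BaseChange φ A →+* BaseChange ψ A :=
  (Algebra.TensorProduct.map
    ({ toRingHom := θ, commutes' := fun c => by subst h; rfl } : Twist φ →ₐ[k] Twist ψ)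
    (AlgHom.id k A)).toRingHom

theorem BaseChange.twist_algebraMap {φ ψ : k →+* k} (θ : k →+* k) (h : ψ = θ.comp φ) (c : k) :
    BaseChange.twist A θ h (algebraMap k _ c) = algebraMap k _ (θ c) :=
  Algebra.TensorProduct.map_tmul _ _ _ _

/-- A `k`-algebra `B`, regarded as a `k`-algebra through the endomorphism `φ`. -/
@[nolint unusedArguments]
def Restrict (_φ : k →+* k) (B : Type*) : Type _ := B

instance (φ : k →+* k) (B : Type*) [CommRing B] : CommRing (Restrict φ B) :=
  inferInstanceAs (CommRing B)

instance (φ : k →+* k) (B : Type*) [CommRing B] [Algebra k B] : Algebra k (Restrict φ B) :=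
  RingHom.toAlgebra (R := k) (S := B) ((algebraMap k B).comp φ)

end BaseChange

/-! ### Generalised difference algebraic groups -/

section Prolongation

variable {n : ℕ} {k : Type*} [CommRing k] (σ : DifferenceStructure n k)
  (A : Type*) [CommRing A] [HopfAlgebra k A]

/-- The coordinate Hopf algebra of the product of the base changes of `𝒢 = Spec A` along all
transforms of order at most `i`. -/
abbrev Prolongation (i : ℕ) : Type _ :=
  ⨂[k] τ : TransformLE n i, BaseChange (σ.transform τ.1) A

namespace Prolongation

variable {i : ℕ}

/-- The embedding of the tensor factor of index `τ`. -/
def single (τ : TransformLE n i) : BaseChange (σ.transform τ.1) A →ₐ[k] Prolongation σ A i :=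
  PiTensorProduct.singleAlgHom (R := k)
    (A := fun τ : TransformLE n i => BaseChange (σ.transform τ.1) A) τ

/-- The natural inclusion `k[𝒢[i]] ⊆ k[𝒢[i + 1]]`, dual to the projection `𝒢[i + 1] → 𝒢[i]`. -/
def incl (i : ℕ) : Prolongation σ A i →ₐ[k] Prolongation σ A (i + 1) :=
  PiTensorProduct.coprodLift fun τ => single σ A τ.incl

/-- The ring homomorphism `σ_j : k[𝒢[i]] → k[𝒢[i + 1]]`: it applies `σ_j` to scalars and takes
the factor of index `τ` to the factor of index `σ_j τ`. -/
def endo (j : Fin n) (i : ℕ) : Prolongation σ A i →+* Prolongation σ A (i + 1) :=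
  (PiTensorProduct.coprodLift (R := k) (S := Restrict (σ.endo j) (Prolongation σ A (i + 1)))
    fun τ : TransformLE n i =>
      { toRingHom := (single σ A (τ.shift j)).toRingHom.comp
          (BaseChange.twist A (σ.endo j) (TransformLE.transform_shift σ j τ))
        commutes' := fun c => by
          change single σ A (τ.shift j) (BaseChange.twist A _ _ (algebraMap k _ c)) = _
          rw [BaseChange.twist_algebraMap, AlgHom.commutes]
          rfl }).toRingHom

end Prolongation

/-- A generalised difference algebraic group with respect to `𝒢 = Spec A`: a sequence of closed
subgroups `G[i]` of `𝒢[i]`, given by their defining Hopf ideals, such that the projections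
`G[i + 1] → G[i]` and `G[i + 1] → ^{σ_j} G[i]` are well defined. -/
structure GeneralisedGroup where
  /-- The defining ideal of `G[i]`. -/
  ideal : ∀ i, Ideal (Prolongation σ A i)
  isHopfIdeal : ∀ i, (ideal i).IsHopfIdeal k
  incl_mem : ∀ i, ∀ f ∈ ideal i, Prolongation.incl σ A i f ∈ ideal (i + 1)
  endo_mem : ∀ i j, ∀ f ∈ ideal i, Prolongation.endo σ A j i f ∈ ideal (i + 1)

end Prolongation

end

/-!
Write `G[i] ⊆ 𝒢[i]` for the closed subgroup defined by `G.ideal i`, and let `H ⊆ 𝒢[i + 1]` be the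
one defined by the ideal that `G.ideal i` generates under the inclusion and the endomorphisms. Then
`G[i + 1] ⊆ H`, and the claim is that equality holds for large `i`.

The indices `τ` of the factors of `𝒢[i]` are ordered lexicographically, which is compatible with
shifts. For a closed subgroup of `𝒢[i]` and an index `τ`, consider its image in the product of the
factors of index at most `τ`, and in that image the kernel of the projection to the factors of
smaller index: a closed subgroup of the factor of index `τ` (`Prolongation.kernelIdeal`). Two
arguments are combined.

*The kernels determine the subgroup* (`PiTensorProduct.eq_of_proj_le`,
`Prolongation.eq_of_kernelIdeal_le`). By induction along the indices this is the following statement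
(`Ideal.IsHopfIdeal.eq_of_comap_le_of_le_sup`): if `G ⊆ H` have the same image `X` under a
homomorphism and the kernel on `H` lies in `G`, then `G = H`. On the level of points, if `g` in `G`
and `h` in `H` have the same image, then `g⁻¹ * h` is in the kernel and hence `h` is in `G`. Applied
to the universal such pair, this shows that the ideal `N` of `G` in `H` vanishes in
`k[G] ⊗ k[H]`, the tensor product over `k[X]`. Localising at an associated prime of `k[X]`, which
is the annihilator of some function, and using that `G` has a point over this prime because
`k[X] → k[G]` is injective, one finds a nonzero `d` in `k[X]` with `d * N = 0`. The annihilator of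
`N` in `k[X]` is invariant under translation by `G`, and a nonzero invariant ideal of `k[X]` is
everything; so `N = 0`. No faithful flatness of Hopf algebras over Hopf subalgebras is needed.

*The kernels stabilise* (`Prolongation.exists_leadExponents_stable`). In a polynomial presentation
of `k[𝒢]` with `r` variables, the steps from `𝒢[i]` to `𝒢[i + 1]` act on the kernels by field
endomorphisms on coefficients, which preserve leading exponents. The triples consisting of `i`, an
index and a leading exponent of the kernel thus form an upward closed set in `ℕ × ℕ ^ n × ℕ ^ r`,
up to a change of coordinates, and Dickson's lemma (`exists_forall_mem_of_succ`) shows that for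
large `i` all leading exponents of the kernels of `G[i + 1]` already occur for `H`. Ideals of a
polynomial ring, one inside the other, with the same leading exponents are equal, so `H` and
`G[i + 1]` have the same kernels.
-/

noncomputable section

/-! ### Points of affine group schemes and Hopf ideals -/

namespace HopfAlgebra
open WithConv

section Points

variable {k B E : Type*} [CommRing k] [CommRing B] [HopfAlgebra k B] [CommRing E] [Algebra k E]

/-- The inverse of an `E`-valued point of the affine group scheme `Spec B`, for an arbitrary
commutative algebra `E`. -/
def pointInv (f : WithConv (B →ₐ[k] E)) : WithConv (B →ₐ[k] E) :=
  toConv (f.ofConv.comp (HopfAlgebra.antipodeAlgHom k B))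

theorem pointInv_mul (f : WithConv (B →ₐ[k] E)) : pointInv f * f = 1 := by
  have h := AlgHom.comp_convMul_distrib f.ofConv
    (toConv (HopfAlgebra.antipodeAlgHom k B)) (toConv (AlgHom.id k B))
  rw [AlgHom.antipode_id_cancel] at h
  refine ofConv_injective (h.symm.trans ?_)
  ext x
  change f.ofConv (algebraMap k B _) = algebraMap k E _
  rw [AlgHom.commutes]

theorem mul_pointInv (f : WithConv (B →ₐ[k] E)) : f * pointInv f = 1 := by
  have h := AlgHom.comp_convMul_distrib f.ofConv
    (toConv (AlgHom.id k B)) (toConv (AlgHom.id k B))⁻¹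
  rw [mul_inv_cancel] at h
  refine ofConv_injective (h.symm.trans ?_)
  ext x
  change f.ofConv (algebraMap k B _) = algebraMap k E _
  rw [AlgHom.commutes]

end Points

/-- A homomorphism of bialgebras between commutative Hopf algebras respects the antipodes. -/
theorem antipode_bialgHom {k B D : Type*} [CommRing k] [CommRing B] [HopfAlgebra k B]
    [CommRing D] [HopfAlgebra k D] (e : D →ₐc[k] B) (x : D) :
    antipode k (e x) = e (antipode k x) := by
  have h := AlgHom.convMul_comp_bialgHom_distrib (toConv (AlgHom.id k B))
    (pointInv (toConv (AlgHom.id k B))) e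
  rw [mul_pointInv] at h
  have h1 : toConv (e : D →ₐ[k] B) *
      toConv ((antipodeAlgHom k B).comp (e : D →ₐ[k] B)) = 1 := by
    refine ofConv_injective (h.symm.trans ?_)
    ext y
    change algebraMap k B (Coalgebra.counit (e y)) = algebraMap k B (Coalgebra.counit y)
    simp
  exact (DFunLike.congr_fun (congrArg ofConv
    (left_inv_eq_right_inv (pointInv_mul (toConv (e : D →ₐ[k] B))) h1)) x).symm

end HopfAlgebra

namespace Ideal
open WithConv HopfAlgebra

section Points
variable {k B E : Type*} [CommRing k] [CommRing B] [HopfAlgebra k B] [CommRing E] [Algebra k E]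

/-- Points of `Spec B` that factor through the closed subgroup defined by a Hopf ideal are closed
under multiplication. -/
theorem IsHopfIdeal.convMul_apply_eq_zero {I : Ideal B} (hI : I.IsHopfIdeal k)
    {f g : WithConv (B →ₐ[k] E)} (hf : ∀ x ∈ I, f x = 0) (hg : ∀ x ∈ I, g x = 0) :
    ∀ x ∈ I, (f * g) x = 0 := by
  intro x hx
  have h := AlgHom.convMul_comp_bialgHom_distrib (toConv (Ideal.Quotient.liftₐ I f.ofConv hf))
    (toConv (Ideal.Quotient.liftₐ I g.ofConv hg)) (Bialgebra.Quotient.mkBialgHom (R := k) I)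
  have hf' : (Ideal.Quotient.liftₐ I f.ofConv hf).comp
      (Bialgebra.Quotient.mkBialgHom (R := k) I : B →ₐ[k] B ⧸ I) = f.ofConv := by ext; rfl
  have hg' : (Ideal.Quotient.liftₐ I g.ofConv hg).comp
      (Bialgebra.Quotient.mkBialgHom (R := k) I : B →ₐ[k] B ⧸ I) = g.ofConv := by ext; rfl
  simp only [hf', hg', toConv_ofConv] at h
  rw [← h]
  rw [AlgHom.comp_apply]
  have h0 : (Bialgebra.Quotient.mkBialgHom (R := k) I : B →ₐ[k] B ⧸ I) x = 0 :=
    Ideal.Quotient.eq_zero_iff_mem.2 hx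
  rw [h0, map_zero]

theorem IsHopfIdeal.pointInv_apply_eq_zero {I : Ideal B} (hI : I.IsHopfIdeal k)
    {f : WithConv (B →ₐ[k] E)} (hf : ∀ x ∈ I, f x = 0) : ∀ x ∈ I, pointInv f x = 0 :=
  fun _ hx => hf _ (hI.antipode_mem hx)

/-- An ideal generated by a set `s` is a Hopf ideal if the unit point kills `s` and the universal
points killing `s` have product and inverse killing `s`. -/
theorem isHopfIdeal_span (s : Set B)
    (h1 : ∀ x ∈ s, Coalgebra.counit (R := k) x = 0)
    (hmul : ∀ x ∈ s,
      (toConv (Algebra.TensorProduct.includeLeft.comp (Ideal.Quotient.mkₐ k (span s))) *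
        toConv (Algebra.TensorProduct.includeRight.comp (Ideal.Quotient.mkₐ k (span s))) :
        WithConv (B →ₐ[k] (B ⧸ span s) ⊗[k] (B ⧸ span s))) x = 0)
    (hinv : ∀ x ∈ s, pointInv (toConv (Ideal.Quotient.mkₐ k (span s))) x = 0) :
    (span s).IsHopfIdeal k := by
  refine { counit_eq_zero := (span_le (I := RingHom.ker (Bialgebra.counitAlgHom k B))).2 h1,
           map_mkQ_comul_eq_zero := fun x hx => ?_, antipode_mem := fun x hx => ?_ }
  · have := (span_le (I := RingHom.ker (ofConv (toConv (Algebra.TensorProduct.includeLeft.comp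
      (Ideal.Quotient.mkₐ k (span s))) *
        toConv (Algebra.TensorProduct.includeRight.comp (Ideal.Quotient.mkₐ k (span s))) :
        WithConv (B →ₐ[k] (B ⧸ span s) ⊗[k] (B ⧸ span s)))))).2 hmul hx
    rw [RingHom.mem_ker, AlgHom.convMul_apply] at this
    refine Eq.trans ?_ this
    generalize Coalgebra.comul (R := k) x = t
    induction t with
    | zero => exact (map_zero _).trans (map_zero _).symm
    | add a b ha hb => exact (map_add _ a b).trans ((congrArg₂ _ ha hb).trans (map_add _ a b).symm)
    | tmul a b =>
      rw [Algebra.TensorProduct.lift_tmul]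
      simp
      rfl
  · exact Ideal.Quotient.eq_zero_iff_mem.1 ((span_le (I := RingHom.ker (ofConv
      (pointInv (toConv (Ideal.Quotient.mkₐ k (span s))))))).2 hinv hx)

end Points

section Field
variable {k B D : Type*} [Field k] [CommRing B] [HopfAlgebra k B] [CommRing D] [HopfAlgebra k D]

/-- The image of a closed subgroup under a homomorphism is a closed subgroup. Over a field, the
injection `D ⧸ I.comap e → B ⧸ I` stays injective after tensoring with itself. -/
theorem IsHopfIdeal.comap {I : Ideal B} (hI : I.IsHopfIdeal k) (e : D →ₐc[k] B) :
    (I.comap e).IsHopfIdeal k where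
  counit_eq_zero x hx := by
    have := hI.counit_eq_zero hx
    simpa using this
  antipode_mem x hx := by
    rw [mem_comap, ← antipode_bialgHom]
    exact hI.antipode_mem hx
  map_mkQ_comul_eq_zero x hx := by
    let K := I.comap e
    let j : D ⧸ K →ₗ[k] B ⧸ I :=
      (Ideal.Quotient.liftₐ K ((Ideal.Quotient.mkₐ k I).comp (e : D →ₐ[k] B)) fun a ha =>
        Ideal.Quotient.eq_zero_iff_mem.2 ha).toLinearMap
    have hj : Function.Injective j := by
      refine (injective_iff_map_eq_zero j).2 fun a => ?_
      obtain ⟨a, rfl⟩ := Ideal.Quotient.mk_surjective a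
      intro h
      exact Ideal.Quotient.eq_zero_iff_mem.2 (Ideal.Quotient.eq_zero_iff_mem.1 h : e a ∈ I)
    have h := hI.map_mkQ_comul_eq_zero hx
    refine TensorProduct.map_injective_of_flat_flat j j hj hj ((?_ : _ = _).trans (map_zero _).symm)
    change TensorProduct.map _ _ (Coalgebra.comul (e x)) = 0 at h
    rw [← CoalgHomClass.map_comp_comul_apply] at h
    refine Eq.trans ?_ h
    have : (TensorProduct.map j j) ∘ₗ (TensorProduct.map (K.restrictScalars k).mkQ
        (K.restrictScalars k).mkQ) = (TensorProduct.map (I.restrictScalars k).mkQ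
        (I.restrictScalars k).mkQ) ∘ₗ TensorProduct.map (e : D →ₗ[k] B) (e : D →ₗ[k] B) := by
      refine TensorProduct.ext' fun a b => rfl
    exact DFunLike.congr_fun this _

end Field
end Ideal

/-! ### Equality of closed subgroups with the same image and the same kernel -/

/-- The kernel of `Y → κ(p) ⊗ Y`: an element killed in the fibre at `p` is carried into `pY` by an
element outside `p`. -/
theorem Ideal.exists_smul_mem_of_residueField_tmul_eq_zero {D Y : Type*} [CommRing D]
    [AddCommGroup Y] [Module D Y] (p : Ideal D) [p.IsPrime] {y : Y}
    (h : (1 : p.ResidueField) ⊗ₜ[D] y = 0) : ∃ s ∉ p, s • y ∈ p • (⊤ : Submodule D Y) := by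
  let Z := (D ⧸ p) ⊗[D] Y
  let f : Z →ₗ[D ⧸ p] p.ResidueField ⊗[D ⧸ p] Z := TensorProduct.mk (D ⧸ p) p.ResidueField Z 1
  have hf : IsLocalizedModule (nonZeroDivisors (D ⧸ p)) f :=
    (isLocalizedModule_iff_isBaseChange _ p.ResidueField f).2 (TensorProduct.isBaseChange _ _ _)
  have h0 : f (1 ⊗ₜ y) = 0 := by
    apply (TensorProduct.AlgebraTensorModule.cancelBaseChange D (D ⧸ p) (D ⧸ p)
      p.ResidueField Y).injective
    rw [map_zero]
    refine Eq.trans ?_ h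
    refine (TensorProduct.AlgebraTensorModule.cancelBaseChange_tmul D (D ⧸ p) (D ⧸ p) 1 y 1).trans
      ?_
    rw [one_smul]
  obtain ⟨⟨s, hs⟩, h1⟩ := (IsLocalizedModule.eq_zero_iff (nonZeroDivisors (D ⧸ p)) f).1 h0
  obtain ⟨s, rfl⟩ := Ideal.Quotient.mk_surjective s
  refine ⟨s, fun hsp => nonZeroDivisors.ne_zero hs (Ideal.Quotient.eq_zero_iff_mem.2 hsp), ?_⟩
  have h2 : (1 : D ⧸ p) ⊗ₜ[D] (s • y) = 0 := by
    rw [TensorProduct.tmul_smul]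
    exact h1
  have h3 := congrArg (TensorProduct.quotTensorEquivQuotSMul Y p) h2
  rw [map_zero] at h3
  have h4 := TensorProduct.quotTensorEquivQuotSMul_mk_tmul p 1 (s • y)
  rw [map_one, h3, one_smul] at h4
  exact (Submodule.Quotient.mk_eq_zero _).1 h4.symm

namespace Ideal
open WithConv HopfAlgebra

section Subgroup
variable {k B D : Type*} [Field k] [CommRing B] [HopfAlgebra k B] [CommRing D] [HopfAlgebra k D]

/-- Let `I ≤ I'` define closed subgroups `G ⊆ H`, and suppose that `G` contains the kernel on `H`
of the homomorphism dual to `e`. A point `h` of `H` with the same image as a point `g` of `G`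
lies in `G`, since `g⁻¹ * h` lies in the kernel. -/
theorem IsHopfIdeal.apply_eq_zero_of_comp_eq {E : Type*} [CommRing E] [Algebra k E]
    (e : D →ₐc[k] B) {I I' : Ideal B} (hI : I.IsHopfIdeal k) (hI' : I'.IsHopfIdeal k) (hle : I ≤ I')
    (hker : I' ≤ I ⊔ span (e '' {d | Coalgebra.counit (R := k) d = 0}))
    {g h : WithConv (B →ₐ[k] E)} (hg : ∀ y ∈ I', g y = 0) (hh : ∀ y ∈ I, h y = 0)
    (hcomp : ∀ d, g (e d) = h (e d)) : ∀ x ∈ I', h x = 0 := by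
  let ψ : WithConv (B →ₐ[k] E) := pointInv g * h
  have hψI : ∀ y ∈ I, ψ y = 0 :=
    hI.convMul_apply_eq_zero (hI.pointInv_apply_eq_zero fun y hy => hg y (hle hy)) hh
  have hψe : ψ.ofConv.comp (e : D →ₐ[k] B) = (1 : WithConv (D →ₐ[k] E)).ofConv := by
    have h1 : (pointInv g).ofConv.comp (e : D →ₐ[k] B) =
        (pointInv (toConv (g.ofConv.comp (e : D →ₐ[k] B)))).ofConv := by
      ext d
      exact congrArg g.ofConv (antipode_bialgHom e d)
    have h2 : h.ofConv.comp (e : D →ₐ[k] B) = g.ofConv.comp (e : D →ₐ[k] B) := by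
      ext d
      exact (hcomp d).symm
    rw [AlgHom.convMul_comp_bialgHom_distrib, h1, h2, toConv_ofConv, pointInv_mul]
  have hψ : I' ≤ RingHom.ker ψ.ofConv := by
    refine hker.trans (sup_le hψI (span_le.2 ?_))
    rintro _ ⟨d, hd, rfl⟩
    refine (DFunLike.congr_fun hψe d).trans ?_
    change algebraMap k E (Coalgebra.counit d) = 0
    rw [hd, map_zero]
  have hfin : g * ψ = h := by
    rw [← mul_assoc, mul_pointInv, one_mul]
  have := hI'.convMul_apply_eq_zero hg hψ
  rwa [hfin] at this

/-- `IsHopfIdeal.apply_eq_zero_of_comp_eq` for the universal pair of a point of `G` and a point of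
`H` with the same image. -/
theorem tmul_mk_eq_zero [Algebra D B] [IsScalarTower k D B] (e : D →ₐc[k] B)
    (he : ∀ d, algebraMap D B d = e d) {I I' : Ideal B}
    (hI : I.IsHopfIdeal k) (hI' : I'.IsHopfIdeal k) (hle : I ≤ I')
    (hker : I' ≤ I ⊔ span (e '' {d | Coalgebra.counit (R := k) d = 0})) {x : B} (hx : x ∈ I') :
    (1 : B ⧸ I') ⊗ₜ[D] (Ideal.Quotient.mk I x) = 0 := by
  refine hI.apply_eq_zero_of_comp_eq (E := (B ⧸ I') ⊗[D] (B ⧸ I)) e hI' hle hker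
    (g := toConv ((Algebra.TensorProduct.includeLeft (R := D) (S := k)).comp
      (Ideal.Quotient.mkₐ k I')))
    (h := toConv (((Algebra.TensorProduct.includeRight (R := D) (A := B ⧸ I')).restrictScalars
      k).comp (Ideal.Quotient.mkₐ k I))) (fun y hy => ?_) (fun y hy => ?_) (fun d => ?_) x hx
  · change (Ideal.Quotient.mk I' y) ⊗ₜ[D] 1 = 0
    rw [Ideal.Quotient.eq_zero_iff_mem.2 hy, TensorProduct.zero_tmul]
  · change 1 ⊗ₜ[D] (Ideal.Quotient.mk I y) = 0
    rw [Ideal.Quotient.eq_zero_iff_mem.2 hy, TensorProduct.tmul_zero]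
  · change (Ideal.Quotient.mk I' (e d)) ⊗ₜ[D] (1 : B ⧸ I) =
      (1 : B ⧸ I') ⊗ₜ[D] (Ideal.Quotient.mk I (e d))
    have h1 : Ideal.Quotient.mk I' (e d) = d • (1 : B ⧸ I') := by
      rw [← he, Algebra.smul_def, mul_one]; rfl
    have h2 : Ideal.Quotient.mk I (e d) = d • (1 : B ⧸ I) := by
      rw [← he, Algebra.smul_def, mul_one]; rfl
    rw [h1, h2, TensorProduct.smul_tmul]

/-- Let `I ≤ I'` define closed subgroups `G ⊆ H` with the same image under the homomorphism dual to
`e`, and let `G` contain the kernel on `H`. Then some function `d`, not zero on the image,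
annihilates the ideal of `G` in `H`. It is found in the fibre over an associated prime of the
image. -/
theorem exists_notMem_comap_forall_mul_mem [IsNoetherianRing D] [IsNoetherianRing B]
    (e : D →ₐc[k] B) {I I' : Ideal B} (hI : I.IsHopfIdeal k) (hI' : I'.IsHopfIdeal k) (hle : I ≤ I')
    (hcomap : I'.comap e ≤ I.comap e)
    (hker : I' ≤ I ⊔ span (e '' {d | Coalgebra.counit (R := k) d = 0})) (htop : I ≠ ⊤) :
    ∃ d : D, e d ∉ I ∧ ∀ x ∈ I', e d * x ∈ I := by
  let _ : Algebra D B := (e : D →+* B).toAlgebra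
  have : IsScalarTower k D B := .of_algebraMap_eq fun c => (AlgHomClass.commutes e c).symm
  let K := I.comap e
  have hK : (1 : D ⧸ K) ≠ 0 := fun h => htop ((eq_top_iff_one _).2 (by
    have := Ideal.Quotient.eq_zero_iff_mem.1 (h : Ideal.Quotient.mk K 1 = 0)
    simpa [K] using this))
  obtain ⟨p, hass, -⟩ := exists_le_isAssociatedPrime_of_isNoetherianRing D (1 : D ⧸ K) hK
  obtain ⟨hp, z, hz⟩ := isAssociatedPrime_iff.1 hass
  obtain ⟨z, rfl⟩ := Ideal.Quotient.mk_surjective z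
  -- modulo `K`, the prime `p` is the annihilator of `z`
  have hpz : ∀ d, d ∈ p ↔ e (d * z) ∈ I := fun d => by
    rw [hz, Submodule.mem_colon_singleton, Submodule.mem_bot]
    exact Ideal.Quotient.eq_zero_iff_mem (I := K) (a := d * z)
  have hsmul {L : Ideal B} (hIL : I ≤ L) {y : B ⧸ L} (hy : y ∈ p • (⊤ : Submodule D (B ⧸ L))) :
      z • y = 0 := by
    refine Submodule.smul_induction_on hy (fun d hd b _ => ?_) fun a b ha hb => ?_
    · obtain ⟨b, rfl⟩ := Ideal.Quotient.mk_surjective b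
      rw [smul_smul, mul_comm]
      refine Ideal.Quotient.eq_zero_iff_mem.2 ?_
      change (d * z) • b ∈ L
      rw [Algebra.smul_def]
      exact L.mul_mem_right _ (hIL ((hpz d).1 hd))
    · rw [smul_add, ha, hb, add_zero]
  -- since `z` kills `p`, vanishing in the fibre over `p` implies being killed by a multiple of `z`
  have hsmul' {L : Ideal B} (hIL : I ≤ L) {b : B}
      (hb : (1 : p.ResidueField) ⊗ₜ[D] (Ideal.Quotient.mk L b) = 0) :
      ∃ s ∉ p, e (s * z) * b ∈ L := by
    obtain ⟨s, hs, h⟩ := p.exists_smul_mem_of_residueField_tmul_eq_zero hb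
    refine ⟨s, hs, ?_⟩
    have := hsmul hIL h
    rw [smul_smul, mul_comm] at this
    replace this : (s * z) • b ∈ L := Ideal.Quotient.eq_zero_iff_mem.1 this
    rwa [Algebra.smul_def] at this
  -- the fibre over `p` of the smaller group is not empty
  have hnt : Nontrivial (p.ResidueField ⊗[D] (B ⧸ I')) := by
    refine ⟨1, 0, fun h => ?_⟩
    obtain ⟨s, hs, h⟩ := hsmul' (L := I') hle (b := 1) h
    rw [mul_one] at h
    exact hs ((hpz s).2 (hcomap h))
  -- over the field `κ(p)`, the nonzero algebra of the fibre of the smaller group is faithfully flat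
  have hzero : ∀ x ∈ I', (1 : p.ResidueField) ⊗ₜ[D] (Ideal.Quotient.mk I x) = 0 := fun x hx => by
    let κ := p.ResidueField
    let R₁ := κ ⊗[D] (B ⧸ I')
    let V := κ ⊗[D] (B ⧸ I)
    have hinj : Function.Injective (Algebra.TensorProduct.includeRight : V →ₐ[κ] R₁ ⊗[κ] V) :=
      Algebra.TensorProduct.includeRight_injective (algebraMap κ R₁).injective
    apply hinj
    let f : (B ⧸ I') ⊗[D] (B ⧸ I) →ₐ[D] R₁ ⊗[κ] V :=
      Algebra.TensorProduct.lift
        ((Algebra.TensorProduct.includeLeft (R := κ) (S := D) (A := R₁) (B := V)).comp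
          (Algebra.TensorProduct.includeRight : (B ⧸ I') →ₐ[D] R₁))
        (((Algebra.TensorProduct.includeRight : V →ₐ[κ] R₁ ⊗[κ] V).restrictScalars D).comp
          (Algebra.TensorProduct.includeRight : (B ⧸ I) →ₐ[D] V))
        fun _ _ => Commute.all (S := R₁ ⊗[κ] V) _ _
    have h1 := congrArg f (tmul_mk_eq_zero e (fun _ => rfl) hI hI' hle hker hx)
    rw [map_zero] at h1 ⊢
    refine Eq.trans ?_ h1
    refine Eq.trans ?_ (Algebra.TensorProduct.lift_tmul _ _ _ _ _).symm
    exact ((congrArg (· * _) (map_one (Algebra.TensorProduct.includeLeft.comp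
      (Algebra.TensorProduct.includeRight : (B ⧸ I') →ₐ[D] R₁) :
        (B ⧸ I') →ₐ[D] R₁ ⊗[κ] V))).trans (one_mul _)).symm
  obtain ⟨t, ht⟩ := IsNoetherian.noetherian I'
  have hfin : ∃ s ∉ p, ∀ x ∈ t, e (s * z) * x ∈ I := by
    have hmem : ∀ x ∈ t, x ∈ I' := fun x hx => ht ▸ subset_span hx
    clear ht
    classical
    induction t using Finset.induction_on with
    | empty => exact ⟨1, (ne_top_iff_one p).1 hp.ne_top, by simp⟩
    | insert a t ha ih =>
      obtain ⟨s, hs, h⟩ := ih fun x hx => hmem x (Finset.mem_insert_of_mem hx)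
      obtain ⟨s', hs', h'⟩ := hsmul' le_rfl (hzero a (hmem a (Finset.mem_insert_self _ _)))
      refine ⟨s * s', fun h => (hp.mem_or_mem h).elim hs hs', fun x hx => ?_⟩
      rcases Finset.mem_insert.1 hx with rfl | hx
      · rw [mul_assoc, map_mul, mul_assoc]
        exact I.mul_mem_left _ h'
      · rw [mul_comm s, mul_assoc, map_mul, mul_assoc]
        exact I.mul_mem_left _ (h x hx)
  obtain ⟨s, hs, h⟩ := hfin
  refine ⟨s * z, fun hm => hs ((hpz s).2 hm), fun x hx => ?_⟩
  rw [← ht] at hx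
  induction hx using Submodule.span_induction with
  | mem y hy => exact h y hy
  | zero => simp
  | add a b _ _ ha hb => rw [mul_add]; exact I.add_mem ha hb
  | smul c y _ hy => rw [smul_eq_mul, mul_left_comm]; exact I.mul_mem_left _ hy

/-- Let `I ≤ I'` define closed subgroups `G ⊆ H`. If `b` annihilates the ideal of `G` in `H`, then
so does each right translate of `b` by a point `r` of `G`. -/
theorem mul_apply_eq_zero_of_convMul {E : Type*} [CommRing E] [Algebra k E] {I I' : Ideal B}
    (hI : I.IsHopfIdeal k) (hI' : I'.IsHopfIdeal k) (hle : I ≤ I') {l r : WithConv (B →ₐ[k] E)}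
    (hl : ∀ y ∈ I, l y = 0) (hr : ∀ y ∈ I', r y = 0) {b : B} (hb : ∀ x ∈ I', b * x ∈ I)
    {x : B} (hx : x ∈ I') : (l * r) b * l x = 0 := by
  let h := l * r
  have hh : ∀ y ∈ I, h y = 0 := hI.convMul_apply_eq_zero hl fun y hy => hr y (hle hy)
  -- `l = h * r⁻¹` and `r⁻¹` factors through the smaller group, so `l x` is in the ideal
  -- generated by the image of `I'` under `h`
  have hlx : l x ∈ span (h.ofConv '' I') := by
    let π := Ideal.Quotient.mkₐ k (span (h.ofConv '' (I' : Set B)))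
    have h1 : π.comp (h * pointInv r).ofConv = π.comp l.ofConv := by
      rw [mul_assoc, mul_pointInv, mul_one]
    rw [AlgHom.comp_convMul_distrib] at h1
    have h2 := hI'.convMul_apply_eq_zero (f := toConv (π.comp h.ofConv))
      (g := toConv (π.comp (pointInv r).ofConv))
      (fun y hy => Ideal.Quotient.eq_zero_iff_mem.2 (subset_span ⟨y, hy, rfl⟩))
      (fun y hy => (congrArg π (hI'.pointInv_apply_eq_zero hr y hy)).trans (map_zero π)) x hx
    rw [h1] at h2
    exact Ideal.Quotient.eq_zero_iff_mem.1 h2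
  change h b * l x = 0
  refine Submodule.span_induction (p := fun y _ => h b * y = 0) ?_ (mul_zero _)
    (fun y z _ _ hy hz => by rw [mul_add, hy, hz, add_zero])
    (fun c y _ hy => by rw [smul_eq_mul, mul_left_comm, hy, mul_zero]) hlx
  rintro _ ⟨y, hy, rfl⟩
  rw [← map_mul]
  exact hh _ (hb y hy)

/-- The functions on the base that annihilate the ideal `I'` of `G` in `H`, where `I ≤ I'`, are
invariant under translation by `G`: the comultiplication of such a function, restricted to the
image of `G` in the second argument, has coefficients of the same kind. -/
theorem exists_comul_eq_sum {ι : Type*} (e : D →ₐc[k] B) {I I' : Ideal B} (hI : I.IsHopfIdeal k)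
    (hI' : I'.IsHopfIdeal k) (hle : I ≤ I') (b : Module.Basis ι k (D ⧸ I'.comap e)) {d : D}
    (hd : ∀ x ∈ I', e d * x ∈ I) :
    ∃ c : ι →₀ D, (∀ i, ∀ x ∈ I', e (c i) * x ∈ I) ∧
      (c.sum fun i m => m ⊗ₜ[k] b i) =
        TensorProduct.map .id (Ideal.Quotient.mkₐ k (I'.comap e)).toLinearMap
          (Coalgebra.comul (R := k) d) := by
  let K := I'.comap e
  let q : D →ₗ[k] D ⧸ K := (Ideal.Quotient.mkₐ k K).toLinearMap
  obtain ⟨c, hc⟩ := TensorProduct.eq_repr_basis_right b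
    (TensorProduct.map .id q (Coalgebra.comul (R := k) d))
  refine ⟨c, fun i x hx => ?_, hc⟩
  let E := (B ⧸ I) ⊗[k] (B ⧸ I')
  let l : WithConv (B →ₐ[k] E) :=
    toConv (Algebra.TensorProduct.includeLeft.comp (Ideal.Quotient.mkₐ k I))
  let r : WithConv (B →ₐ[k] E) :=
    toConv (Algebra.TensorProduct.includeRight.comp (Ideal.Quotient.mkₐ k I'))
  have hl : ∀ y ∈ I, l y = 0 := fun y hy => by
    change (Ideal.Quotient.mk I y) ⊗ₜ[k] 1 = 0
    rw [Ideal.Quotient.eq_zero_iff_mem.2 hy, TensorProduct.zero_tmul]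
  have hr : ∀ y ∈ I', r y = 0 := fun y hy => by
    change 1 ⊗ₜ[k] (Ideal.Quotient.mk I' y) = 0
    rw [Ideal.Quotient.eq_zero_iff_mem.2 hy, TensorProduct.tmul_zero]
  have hzero : (l * r) (e d) * l x = 0 := mul_apply_eq_zero_of_convMul hI hI' hle hl hr hd hx
  let j : D ⧸ K →ₗ[k] B ⧸ I' :=
    (Ideal.Quotient.liftₐ K ((Ideal.Quotient.mkₐ k I').comp (e : D →ₐ[k] B)) fun a ha =>
      Ideal.Quotient.eq_zero_iff_mem.2 ha).toLinearMap
  have hj : Function.Injective j := by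
    refine (injective_iff_map_eq_zero j).2 fun a => ?_
    obtain ⟨a, rfl⟩ := Ideal.Quotient.mk_surjective a
    intro h
    exact Ideal.Quotient.eq_zero_iff_mem.2 (Ideal.Quotient.eq_zero_iff_mem.1 h : e a ∈ I')
  let m : D →ₗ[k] B ⧸ I := (Ideal.Quotient.mkₐ k I).toLinearMap ∘ₗ
    LinearMap.mulRight k x ∘ₗ (e : D →ₐ[k] B).toLinearMap
  have hm (t : D ⊗[k] D) : TensorProduct.map m j (TensorProduct.map .id q t) =
      Algebra.TensorProduct.lift l.ofConv r.ofConv (fun _ _ => Commute.all _ _)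
        (TensorProduct.map (e : D →ₗ[k] B) (e : D →ₗ[k] B) t) * l x := by
    induction t with
    | zero => simp only [map_zero, zero_mul]
    | add a b ha hb => simp only [map_add, add_mul, ha, hb]
    | tmul a b =>
      simp only [TensorProduct.map_tmul, Algebra.TensorProduct.lift_tmul]
      change Ideal.Quotient.mk I (e a * x) ⊗ₜ[k] Ideal.Quotient.mk I' (e b) =
        (Ideal.Quotient.mk I (e a) ⊗ₜ[k] 1) * (1 ⊗ₜ[k] Ideal.Quotient.mk I' (e b)) *
          (Ideal.Quotient.mk I x ⊗ₜ[k] 1)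
      rw [Algebra.TensorProduct.tmul_mul_tmul, Algebra.TensorProduct.tmul_mul_tmul, mul_one,
        one_mul, mul_one, map_mul]
  have h3 : TensorProduct.map m j (c.sum fun i m => m ⊗ₜ[k] b i) = 0 := by
    rw [hc, hm, CoalgHomClass.map_comp_comul_apply, ← AlgHom.convMul_apply]
    exact hzero
  have h4 : ((c.mapRange m (map_zero m)).sum fun i m => m ⊗ₜ[k] b i) = 0 := by
    refine TensorProduct.map_injective_of_flat_flat (.id : (B ⧸ I) →ₗ[k] (B ⧸ I)) j
      Function.injective_id hj ?_
    rw [map_zero, ← h3, Finsupp.sum_mapRange_index (fun i => TensorProduct.zero_tmul _ (b i)),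
      Finsupp.sum, Finsupp.sum, map_sum, map_sum]
    rfl
  have h5 := DFunLike.congr_fun (TensorProduct.sum_tmul_basis_right_eq_zero b _ h4) i
  rw [Finsupp.mapRange_apply] at h5
  exact Ideal.Quotient.eq_zero_iff_mem.1 h5

/-- Rigidity of subgroups: let `I ≤ I'` define closed subgroups `G ⊆ H` and let `e` be dual to a
homomorphism. If `G` and `H` have the same image and the kernel on `H` is contained in `G`, then
`G = H`. -/
theorem IsHopfIdeal.eq_of_comap_le_of_le_sup [IsNoetherianRing D] [IsNoetherianRing B]
    (e : D →ₐc[k] B) {I I' : Ideal B} (hI : I.IsHopfIdeal k) (hI' : I'.IsHopfIdeal k) (hle : I ≤ I')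
    (hcomap : I'.comap e ≤ I.comap e)
    (hker : I' ≤ I ⊔ span (e '' {d | Coalgebra.counit (R := k) d = 0})) : I = I' := by
  rcases eq_or_ne I ⊤ with rfl | htop
  · exact (top_le_iff.1 hle).symm
  obtain ⟨d, hdI, hd⟩ := exists_notMem_comap_forall_mul_mem e hI hI' hle hcomap hker htop
  let K := I'.comap e
  have : K.IsHopfIdeal k := hI'.comap e
  let q : D →ₗ[k] D ⧸ K := (Ideal.Quotient.mkₐ k K).toLinearMap
  let b := Module.Basis.ofVectorSpace k (D ⧸ K)
  obtain ⟨c, hc, hsum⟩ := exists_comul_eq_sum e hI hI' hle b hd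
  -- otherwise `d` would vanish on the image, since `d` is the sum of the `ε(cᵢ) bᵢ` there
  have h1 : ∃ i, Coalgebra.counit (R := k) (c i) ≠ 0 := by
    by_contra! h0
    have h2 := congrArg (TensorProduct.map (Coalgebra.counit (R := k) (A := D)) .id) hsum
    rw [Finsupp.sum, map_sum, Finset.sum_eq_zero fun i _ => by
      rw [TensorProduct.map_tmul, h0, TensorProduct.zero_tmul]] at h2
    have h3 : TensorProduct.map (Coalgebra.counit (R := k) (A := D)) .id ∘ₗ
        TensorProduct.map .id q = TensorProduct.map .id q ∘ₗ
        (Coalgebra.counit (R := k) (A := D)).rTensor D := TensorProduct.ext' fun _ _ => rfl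
    have h4 := DFunLike.congr_fun h3 (Coalgebra.comul (R := k) d)
    rw [LinearMap.comp_apply, ← h2, LinearMap.comp_apply, Coalgebra.rTensor_counit_comul,
      TensorProduct.map_tmul] at h4
    have h5 := congrArg (TensorProduct.lid k (D ⧸ K)) h4
    rw [map_zero, TensorProduct.lid_tmul, LinearMap.id_apply, one_smul] at h5
    exact hdI (hcomap (Ideal.Quotient.eq_zero_iff_mem.1 h5.symm))
  obtain ⟨i, hi⟩ := h1
  obtain ⟨c', hc', hsum'⟩ := exists_comul_eq_sum e hI hI' hle b (hc i)
  have h2 := HopfAlgebra.mul_antipode_lTensor_comul_apply (R := k) (Ideal.Quotient.mk K (c i))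
  have h3 : (HopfAlgebra.antipode k (A := D ⧸ K)).lTensor (D ⧸ K)
      (Coalgebra.comul (R := k) (Ideal.Quotient.mk K (c i))) =
      TensorProduct.map q (HopfAlgebra.antipode k (A := D ⧸ K))
        (c'.sum fun i m => m ⊗ₜ[k] b i) := by
    rw [hsum', Bialgebra.Quotient.comul_mk]
    have : (HopfAlgebra.antipode k (A := D ⧸ K)).lTensor (D ⧸ K) ∘ₗ TensorProduct.map q q =
      TensorProduct.map q (HopfAlgebra.antipode k (A := D ⧸ K)) ∘ₗ TensorProduct.map .id q :=
      TensorProduct.ext' fun _ _ => rfl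
    exact DFunLike.congr_fun this _
  rw [h3, Finsupp.sum, map_sum, map_sum] at h2
  refine le_antisymm hle fun x hx => ?_
  -- the sum of the `c'ᵢ S(bᵢ)` annihilates the ideal and is a nonzero scalar on the image
  have hdiff : ∃ s : D, (∀ x ∈ I', e s * x ∈ I) ∧
      Ideal.Quotient.mk K s = algebraMap k _ (Coalgebra.counit (R := k) (c i)) := by
    choose a ha using fun i => Ideal.Quotient.mk_surjective (HopfAlgebra.antipode k (b i))
    refine ⟨∑ i ∈ c'.support, c' i * a i, fun x hx => ?_, ?_⟩
    · rw [map_sum, Finset.sum_mul]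
      refine I.sum_mem fun i _ => ?_
      rw [map_mul, mul_right_comm]
      exact I.mul_mem_right _ (hc' i x hx)
    · rw [Bialgebra.Quotient.counit_mk] at h2
      rw [← h2, map_sum]
      refine Finset.sum_congr rfl fun i _ => ?_
      rw [map_mul, ha, TensorProduct.map_tmul, LinearMap.mul'_apply]
      rfl
  obtain ⟨s, hs, hs'⟩ := hdiff
  have h6 : e (s - algebraMap k D (Coalgebra.counit (R := k) (c i))) ∈ I := by
    refine hcomap (Ideal.Quotient.eq_zero_iff_mem.1 ?_)
    rw [map_sub, hs', sub_eq_zero]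
    rfl
  have h7 := I.sub_mem (hs x hx) (I.mul_mem_right x h6)
  rw [← sub_mul, ← map_sub, sub_sub_cancel, AlgHomClass.commutes, ← Algebra.smul_def] at h7
  have h8 := (I.restrictScalars k).smul_mem (Coalgebra.counit (R := k) (c i))⁻¹ h7
  rwa [smul_smul, inv_mul_cancel₀ hi, one_smul] at h8

end Subgroup
end Ideal

/-! ### Closed subgroups of finite products -/

namespace PiTensorProduct

section CommRing

variable {ι R : Type*} {A : ι → Type*} [Fintype ι] [DecidableEq ι] [CommRing R]
  [∀ i, CommRing (A i)] [∀ i, HopfAlgebra R (A i)]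

open Classical in
/-- The endomorphism of a finite tensor product of Hopf algebras that is the identity on the
factors with index in `s` and the counit on the other factors. It is dual to the projection of a
product of group schemes to the subproduct indexed by `s`. -/
def proj (s : Set ι) : (⨂[R] i, A i) →ₐ[R] (⨂[R] i, A i) :=
  coprodLift fun i => if i ∈ s then singleAlgHom i else
    (Algebra.ofId R _).comp (Bialgebra.counitAlgHom R (A i))

theorem proj_single_of_mem {s : Set ι} {i : ι} (h : i ∈ s) (a : A i) :
    proj s (singleAlgHom (R := R) i a) = singleAlgHom (R := R) i a := by
  rw [proj, coprodLift_single, if_pos h]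

theorem proj_single_of_notMem {s : Set ι} {i : ι} (h : i ∉ s) (a : A i) :
    proj s (singleAlgHom (R := R) i a) = algebraMap R _ (Coalgebra.counit (R := R) a) := by
  rw [proj, coprodLift_single, if_neg h]
  rfl

theorem proj_proj (s t : Set ι) (x : ⨂[R] i, A i) : proj s (proj t x) = proj (s ∩ t) x := by
  refine DFunLike.congr_fun (f := (proj s).comp (proj t)) (algHom_ext fun i => ?_) x
  ext a
  change proj s (proj t (singleAlgHom i a)) = proj (s ∩ t) (singleAlgHom i a)
  by_cases ht : i ∈ t
  · by_cases hs : i ∈ s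
    · rw [proj_single_of_mem ht, proj_single_of_mem hs,
        proj_single_of_mem (s := s ∩ t) ⟨hs, ht⟩]
    · rw [proj_single_of_mem ht, proj_single_of_notMem hs,
        proj_single_of_notMem (s := s ∩ t) fun h => hs h.1]
  · rw [proj_single_of_notMem ht, AlgHom.commutes,
      proj_single_of_notMem (s := s ∩ t) fun h => ht h.2]

theorem proj_univ (x : ⨂[R] i, A i) : proj Set.univ x = x := by
  refine DFunLike.congr_fun (g := AlgHom.id R _) (algHom_ext fun i => ?_) x
  ext a
  exact proj_single_of_mem (Set.mem_univ i) a

theorem counit_single (i : ι) (a : A i) :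
    Coalgebra.counit (R := R) (singleAlgHom (R := R) (A := A) i a) = Coalgebra.counit a :=
  DFunLike.congr_fun (hopfCounit_comp_single (R := R) (A := A) i) a

theorem comul_single (i : ι) (a : A i) :
    Coalgebra.comul (R := R) (singleAlgHom (R := R) (A := A) i a) =
      Algebra.TensorProduct.map (singleAlgHom i) (singleAlgHom i) (Coalgebra.comul (R := R) a) :=
  DFunLike.congr_fun (hopfComul_comp_single (R := R) (A := A) i) a

/-- The projection `PiTensorProduct.proj` as a homomorphism of bialgebras. -/
def projBialgHom (s : Set ι) : (⨂[R] i, A i) →ₐc[R] (⨂[R] i, A i) :=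
  .ofAlgHom (proj s)
    (algHom_ext fun i => AlgHom.ext fun a => by
      change Coalgebra.counit (R := R) (proj s (singleAlgHom (R := R) (A := A) i a)) =
        Coalgebra.counit (R := R) (singleAlgHom (R := R) (A := A) i a)
      by_cases h : i ∈ s
      · rw [proj_single_of_mem h]
      · rw [proj_single_of_notMem h, counit_single, Bialgebra.counit_algebraMap])
    (algHom_ext fun i => AlgHom.ext fun a => by
      change Algebra.TensorProduct.map (proj s) (proj s)
        (Coalgebra.comul (R := R) (singleAlgHom (R := R) (A := A) i a)) =
          Coalgebra.comul (R := R) (proj s (singleAlgHom (R := R) (A := A) i a))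
      by_cases h : i ∈ s
      · rw [proj_single_of_mem h, comul_single, ← AlgHom.comp_apply,
          ← Algebra.TensorProduct.map_comp]
        have : (proj s).comp (singleAlgHom (R := R) (A := A) i) = singleAlgHom i :=
          AlgHom.ext fun a => proj_single_of_mem h a
        rw [this]
      · rw [proj_single_of_notMem h, comul_single, ← AlgHom.comp_apply,
          ← Algebra.TensorProduct.map_comp]
        have : (proj s).comp (singleAlgHom (R := R) (A := A) i) =
            (Algebra.ofId R _).comp (Bialgebra.counitAlgHom R (A i)) :=
          AlgHom.ext fun a => proj_single_of_notMem h a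
        rw [this, Algebra.TensorProduct.map_comp, AlgHom.comp_apply, Bialgebra.comul_algebraMap]
        have h1 (t : A i ⊗[R] A i) : Algebra.TensorProduct.map (Bialgebra.counitAlgHom R (A i))
            (Bialgebra.counitAlgHom R (A i)) t =
            1 ⊗ₜ[R] (Coalgebra.counit (R := R)
              (TensorProduct.lid R (A i) ((Coalgebra.counit (R := R)).rTensor (A i) t))) := by
          induction t with
          | zero => simp
          | add a b ha hb => simp only [map_add, ha, hb, TensorProduct.tmul_add]
          | tmul a b =>
            simp only [Algebra.TensorProduct.map_tmul, Bialgebra.counitAlgHom_apply,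
              LinearMap.rTensor_tmul, TensorProduct.lid_tmul, map_smul, smul_eq_mul]
            rw [← smul_eq_mul (Coalgebra.counit (R := R) a), ← TensorProduct.smul_tmul,
              smul_eq_mul, mul_one]
        rw [h1, Coalgebra.rTensor_counit_comul, TensorProduct.lid_tmul, one_smul,
          Algebra.TensorProduct.map_tmul, map_one, Algebra.TensorProduct.algebraMap_apply,
          Algebra.algebraMap_eq_smul_one, TensorProduct.smul_tmul,
          ← Algebra.algebraMap_eq_smul_one]
        rfl)

end CommRing

section Field

variable {ι k Λ : Type*} {A : ι → Type*} [Fintype ι] [DecidableEq ι] [Field k]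
  [∀ i, CommRing (A i)] [∀ i, HopfAlgebra k (A i)] [LinearOrder Λ]

theorem mem_comap_projBialgHom (I : Ideal (⨂[k] i, A i)) (s : Set ι) (x : ⨂[k] i, A i) :
    x ∈ I.comap (projBialgHom s) ↔ proj s x ∈ I := Iff.rfl

/-- For functions of the factors in `insert i s`, restriction to the kernel of the projection to the
factors in `s` is restriction to the factor `i`. -/
theorem proj_insert_sub_mem_span (s : Set ι) (i : ι) (x : ⨂[k] i, A i) :
    proj (insert i s) x - proj {i} x ∈
      Ideal.span (projBialgHom s '' {d : ⨂[k] i, A i | Coalgebra.counit (R := k) d = 0}) := by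
  set J := Ideal.span (projBialgHom s '' {d : ⨂[k] i, A i | Coalgebra.counit (R := k) d = 0})
  refine (Ideal.Quotient.mk_eq_mk_iff_sub_mem _ _).1 ?_
  refine DFunLike.congr_fun (f := (Ideal.Quotient.mkₐ k J).comp (proj (insert i s)))
    (g := (Ideal.Quotient.mkₐ k J).comp (proj {i})) (algHom_ext fun j => AlgHom.ext fun a => ?_) x
  change Ideal.Quotient.mk J (proj (insert i s) (singleAlgHom j a)) =
    Ideal.Quotient.mk J (proj {i} (singleAlgHom j a))
  by_cases hj : j = i
  · rw [proj_single_of_mem (s := insert i s) (Or.inl hj), proj_single_of_mem (s := {i}) hj]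
  rw [proj_single_of_notMem (s := {i}) hj]
  by_cases hs : j ∈ s
  · rw [proj_single_of_mem (s := insert i s) (Or.inr hs), Ideal.Quotient.mk_eq_mk_iff_sub_mem]
    refine Ideal.subset_span ⟨singleAlgHom j a - algebraMap k _ (Coalgebra.counit (R := k) a),
      ?_, ?_⟩
    · rw [Set.mem_ofPred_eq, map_sub, counit_single, Bialgebra.counit_algebraMap, sub_self]
    · change proj s _ = _
      rw [map_sub, proj_single_of_mem hs, AlgHom.commutes]
  · rw [proj_single_of_notMem (s := insert i s) fun h => h.elim hj hs]

theorem comap_proj_empty {I : Ideal (⨂[k] i, A i)} (hI : I.IsHopfIdeal k) :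
    I.comap (projBialgHom (∅ : Set ι)) = RingHom.ker (Bialgebra.counitAlgHom k (⨂[k] i, A i)) := by
  have h1 : proj (∅ : Set ι) = (Algebra.ofId k (⨂[k] i, A i)).comp
      (Bialgebra.counitAlgHom k _) := algHom_ext fun i => AlgHom.ext fun a =>
    (proj_single_of_notMem (Set.notMem_empty i) a).trans
      (congrArg (algebraMap k _) (counit_single i a).symm)
  ext x
  have h2 : projBialgHom (∅ : Set ι) x = algebraMap k _ (Coalgebra.counit (R := k) x) :=
    DFunLike.congr_fun h1 x
  rw [Ideal.mem_comap, h2, RingHom.mem_ker, Bialgebra.counitAlgHom_apply]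
  refine ⟨fun h => ?_, fun h => by rw [h, map_zero]; exact I.zero_mem⟩
  rw [← Bialgebra.counit_algebraMap (A := ⨂[k] i, A i) (Coalgebra.counit (R := k) x)]
  exact hI.counit_eq_zero h

/-- Two closed subgroups `G ⊆ H` of a product with the same projection to the factors in `s` have
the same projection to those in `insert i s` if the kernels over the former agree. -/
theorem comap_proj_insert_eq [IsNoetherianRing (⨂[k] i, A i)] (s : Set ι) (i : ι)
    {I I' : Ideal (⨂[k] i, A i)} (hI : I.IsHopfIdeal k) (hI' : I'.IsHopfIdeal k) (hle : I ≤ I')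
    (hs : ∀ x, proj s x ∈ I' → proj s x ∈ I)
    (h : ∀ f ∈ I', proj (insert i s) f = f →
      ∃ g ∈ I, proj (insert i s) g = g ∧ proj {i} g = proj {i} f) :
    I.comap (projBialgHom (insert i s)) = I'.comap (projBialgHom (insert i s)) := by
  have hTs (x : ⨂[k] i, A i) : proj (insert i s) (proj s x) = proj s x := by
    rw [proj_proj, Set.inter_eq_right.2 (Set.subset_insert i s)]
  have hTT (x : ⨂[k] i, A i) : proj (insert i s) (proj (insert i s) x) = proj (insert i s) x := by
    rw [proj_proj, Set.inter_self]
  refine (hI.comap (projBialgHom (insert i s))).eq_of_comap_le_of_le_sup (projBialgHom s)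
    (hI'.comap _) (Ideal.comap_mono hle) (fun x hx => ?_) (fun f hf => ?_)
  · have hx' : proj (insert i s) (proj s x) ∈ I' := hx
    change proj (insert i s) (proj s x) ∈ I
    rw [hTs] at hx' ⊢
    exact hs x hx'
  · obtain ⟨g, hg, hgT, hgi⟩ := h (proj (insert i s) f) hf (hTT f)
    have h1 := proj_insert_sub_mem_span s i (proj (insert i s) f)
    have h2 := proj_insert_sub_mem_span s i g
    rw [hTT] at h1
    rw [hgT, hgi] at h2
    have h4 : g + (f - proj (insert i s) f) ∈ I.comap (projBialgHom (insert i s)) := by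
      change proj (insert i s) (g + (f - proj (insert i s) f)) ∈ I
      rw [map_add, map_sub, hTT, sub_self, add_zero, hgT]
      exact hg
    have h5 := Ideal.add_mem _ (Ideal.mem_sup_left h4)
      (Ideal.mem_sup_right (Ideal.sub_mem _ h1 h2))
    convert h5 using 1
    abel

/-- A closed subgroup of a finite product of groups is determined, inside a larger one, by the
successive kernels of its projections to initial subproducts. The order on the factors is given by
the function `key`. -/
theorem eq_of_proj_le [IsNoetherianRing (⨂[k] i, A i)] (key : ι → Λ) (hkey : key.Injective)
    {I I' : Ideal (⨂[k] i, A i)} (hI : I.IsHopfIdeal k) (hI' : I'.IsHopfIdeal k) (hle : I ≤ I')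
    (h : ∀ i, ∀ f ∈ I', proj {j | key j ≤ key i} f = f →
      ∃ g ∈ I, proj {j | key j ≤ key i} g = g ∧ proj {i} g = proj {i} f) : I = I' := by
  have main (s : Finset ι) : (∀ i ∈ s, ∀ j, key j ≤ key i → j ∈ s) →
      I.comap (projBialgHom (s : Set ι)) = I'.comap (projBialgHom (s : Set ι)) := by
    refine Finset.induction_on_max_value key s ?_ ?_
    · intro _
      rw [Finset.coe_empty, comap_proj_empty hI, comap_proj_empty hI']
    · intro i s hi hmax ih hlow
      have hT : (insert i (s : Set ι)) = {j | key j ≤ key i} := by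
        rw [← Finset.coe_insert]
        ext j
        rw [Finset.mem_coe]
        refine ⟨fun hj => ?_, hlow i (Finset.mem_insert_self _ _) j⟩
        rcases Finset.mem_insert.1 hj with rfl | hj
        · exact le_refl (key j)
        · exact hmax j hj
      have hs := ih fun j hj l hl => by
        rcases Finset.mem_insert.1 (hlow j (Finset.mem_insert_of_mem hj) l hl) with rfl | h
        · exact absurd (hkey (le_antisymm hl (hmax j hj))) fun h => hi (h ▸ hj)
        · exact h
      have h1 : ∀ x, proj (s : Set ι) x ∈ I' → proj (s : Set ι) x ∈ I := fun x hx => by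
        rw [← mem_comap_projBialgHom] at hx ⊢
        rwa [hs]
      have h2 : ∀ f ∈ I', proj (insert i (s : Set ι)) f = f →
          ∃ g ∈ I, proj (insert i (s : Set ι)) g = g ∧ proj {i} g = proj {i} f := by
        rw [hT]
        exact h i
      have h3 := comap_proj_insert_eq (s : Set ι) i hI hI' hle h1 h2
      rw [Finset.coe_insert]
      exact h3
  have huniv := main Finset.univ fun _ _ j _ => Finset.mem_univ j
  rw [Finset.coe_univ] at huniv
  refine le_antisymm hle fun x hx => ?_
  rwa [← proj_univ x, ← mem_comap_projBialgHom, huniv, mem_comap_projBialgHom, proj_univ]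

end Field

end PiTensorProduct

/-! ### Base change and prolongations -/

namespace PiTensorProduct

variable {ι R : Type*} {A : ι → Type*} [Fintype ι] [DecidableEq ι] [CommRing R]
  [∀ i, CommRing (A i)] [∀ i, Algebra R (A i)]

theorem mem_of_single_mem (S : Subalgebra R (⨂[R] i, A i))
    (h : ∀ i (a : A i), singleAlgHom (R := R) i a ∈ S) (x : ⨂[R] i, A i) : x ∈ S := by
  have h1 : coprodLift (fun i => singleAlgHom (R := R) (A := A) i) = AlgHom.id R _ :=
    algHom_ext fun i => coprodLift_comp_single _ i
  induction x using PiTensorProduct.induction_on with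
  | smul_tprod r a =>
    refine S.smul_mem ?_ r
    have h2 := coprodLift_tprod (fun i => singleAlgHom (R := R) (A := A) i) a
    rw [h1, AlgHom.id_apply] at h2
    rw [h2]
    exact S.prod_mem fun i _ => h i (a i)
  | add a b ha hb => exact S.add_mem ha hb

instance finiteType [∀ i, Algebra.FiniteType R (A i)] : Algebra.FiniteType R (⨂[R] i, A i) := by
  have h1 (s : Finset ι) : (s.sup fun i => (singleAlgHom (R := R) (A := A) i).range).FG := by
    induction s using Finset.induction_on with
    | empty => rw [Finset.sup_empty]; exact Subalgebra.fg_bot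
    | insert i s _ ih =>
      rw [Finset.sup_insert]
      refine Subalgebra.FG.sup ?_ ih
      rw [← Algebra.map_top]
      exact Algebra.FiniteType.out.map _
  have h2 : (Finset.univ.sup fun i => (singleAlgHom (R := R) (A := A) i).range) = ⊤ :=
    eq_top_iff.2 fun x _ => mem_of_single_mem _ (fun i a =>
      (Finset.le_sup (f := fun i => (singleAlgHom (R := R) (A := A) i).range)
        (Finset.mem_univ i)) ⟨a, rfl⟩) x
  exact ⟨h2 ▸ h1 Finset.univ⟩

end PiTensorProduct

section BaseChange

variable {k : Type*} [CommRing k] (A : Type*) [CommRing A] [HopfAlgebra k A]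

instance (φ : k →+* k) [Algebra.FiniteType k A] : Algebra.FiniteType k (BaseChange φ A) :=
  inferInstanceAs (Algebra.FiniteType (Twist φ) (Twist φ ⊗[k] A))

/-- The `φ`-semilinear map `a ↦ 1 ⊗ a` from an algebra to its base change along `φ`. -/
def BaseChange.of (φ : k →+* k) : A →+* BaseChange φ A :=
  (Algebra.TensorProduct.includeRight : A →ₐ[k] Twist φ ⊗[k] A).toRingHom

variable {A}

theorem BaseChange.of_algebraMap (φ : k →+* k) (c : k) :
    BaseChange.of A φ (algebraMap k A c) = algebraMap k (BaseChange φ A) (φ c) :=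
  (Algebra.TensorProduct.includeRight : A →ₐ[k] Twist φ ⊗[k] A).commutes c

theorem BaseChange.induction_on {φ : k →+* k} {motive : BaseChange φ A → Prop}
    (x : BaseChange φ A) (smul_of : ∀ c a, motive (algebraMap k _ c * BaseChange.of A φ a))
    (add : ∀ x y, motive x → motive y → motive (x + y)) : motive x := by
  refine TensorProduct.induction_on (R := k) (M := Twist φ) (N := A) x ?_ (fun c a => ?_) add
  · have := smul_of 0 0
    rwa [map_zero, zero_mul] at this
  · have := smul_of c a
    have h : (algebraMap k (BaseChange φ A) c * BaseChange.of A φ a) = (c : Twist φ) ⊗ₜ[k] a :=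
      (Algebra.TensorProduct.tmul_mul_tmul (R := k) (A := Twist φ) (B := A) c 1 1 a).trans
        (by rw [mul_one, one_mul])
    rwa [h] at this

theorem BaseChange.counit_of (φ : k →+* k) (a : A) :
    Coalgebra.counit (R := k) (BaseChange.of A φ a) = φ (Coalgebra.counit (R := k) a) := by
  have h := TensorProduct.counit_tmul (R := k) (S := Twist φ) (A := Twist φ) (B := A) 1 a
  refine Eq.trans h ?_
  change Coalgebra.counit (R := k) a • (1 : Twist φ) = _
  rw [Algebra.smul_def, mul_one]
  rfl

theorem BaseChange.comul_of (φ : k →+* k) (a : A) {ι : Type*} (r : Coalgebra.Repr k a ι) :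
    Coalgebra.comul (R := k) (BaseChange.of A φ a) =
      ∑ i ∈ r.index, BaseChange.of A φ (r.left i) ⊗ₜ[k] BaseChange.of A φ (r.right i) := by
  have h := TensorProduct.comul_tmul (R := k) (S := Twist φ) (A := Twist φ) (B := A) 1 a
  refine Eq.trans h ?_
  rw [← r.eq, TensorProduct.tmul_sum, map_sum]
  rfl

theorem BaseChange.twist_of {φ ψ : k →+* k} (θ : k →+* k) (h : ψ = θ.comp φ) (a : A) :
    BaseChange.twist A θ h (BaseChange.of A φ a) = BaseChange.of A ψ a := by
  refine (Algebra.TensorProduct.map_tmul _ _ _ _).trans ?_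
  rw [map_one]
  rfl

end BaseChange

namespace Prolongation

open WithConv

variable {n : ℕ} {k : Type*} [CommRing k] (σ : DifferenceStructure n k)
  {A : Type*} [CommRing A] [HopfAlgebra k A] {i : ℕ}

/-- The coordinate function of index `τ` attached to `a`. -/
def gen (τ : TransformLE n i) : A →+* Prolongation σ A i :=
  (single σ A τ).toRingHom.comp (BaseChange.of A (σ.transform τ.1))

theorem gen_apply (τ : TransformLE n i) (a : A) :
    gen σ τ a = PiTensorProduct.singleAlgHom (R := k)
      (A := fun τ : TransformLE n i => BaseChange (σ.transform τ.1) A) τ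
        (BaseChange.of A (σ.transform τ.1) a) := rfl

theorem gen_algebraMap (τ : TransformLE n i) (c : k) :
    gen σ τ (algebraMap k A c) = algebraMap k _ (σ.transform τ.1 c) :=
  (congrArg (single σ A τ) (BaseChange.of_algebraMap _ c)).trans (AlgHom.commutes _ _)

theorem mem_of_gen_mem (S : Subalgebra k (Prolongation σ A i)) (h : ∀ τ a, gen σ τ a ∈ S)
    (x : Prolongation σ A i) : x ∈ S := by
  refine PiTensorProduct.mem_of_single_mem S (fun τ b => ?_) x
  change single σ A τ b ∈ S
  refine BaseChange.induction_on (motive := fun b => single σ A τ b ∈ S) b (fun c a => ?_)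
    fun x y hx hy => ?_
  · rw [map_mul, AlgHom.commutes]
    exact S.mul_mem (S.algebraMap_mem c) (h τ a)
  · rw [map_add]
    exact S.add_mem hx hy

theorem ringHom_ext {T : Type*} [CommRing T] {f g : Prolongation σ A i →+* T}
    (hk : ∀ c, f (algebraMap k _ c) = g (algebraMap k _ c))
    (hgen : ∀ τ a, f (gen σ τ a) = g (gen σ τ a)) : f = g := by
  ext x
  refine mem_of_gen_mem σ { RingHom.eqLocus f g with algebraMap_mem' := hk } hgen x

theorem counit_gen (τ : TransformLE n i) (a : A) :
    Coalgebra.counit (R := k) (gen σ τ a) = σ.transform τ.1 (Coalgebra.counit (R := k) a) := by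
  rw [gen_apply, PiTensorProduct.counit_single, BaseChange.counit_of]

theorem convMul_gen {E : Type*} [CommRing E] [Algebra k E]
    (f g : WithConv (Prolongation σ A i →ₐ[k] E)) (τ : TransformLE n i) (a : A) {ι : Type*}
    (r : Coalgebra.Repr k a ι) :
    (f * g) (gen σ τ a) = ∑ j ∈ r.index, f (gen σ τ (r.left j)) * g (gen σ τ (r.right j)) := by
  rw [AlgHom.convMul_apply]
  have h : Coalgebra.comul (R := k) (gen σ τ a) =
      ∑ j ∈ r.index, gen σ τ (r.left j) ⊗ₜ[k] gen σ τ (r.right j) := by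
    rw [gen_apply, PiTensorProduct.comul_single, BaseChange.comul_of _ a r, map_sum]
    rfl
  rw [h, map_sum]
  exact Finset.sum_congr rfl fun j _ => Algebra.TensorProduct.lift_tmul _ _ _ _ _

theorem proj_gen_of_mem {s : Set (TransformLE n i)} {τ : TransformLE n i} (h : τ ∈ s) (a : A) :
    PiTensorProduct.proj s (gen σ τ a) = gen σ τ a :=
  PiTensorProduct.proj_single_of_mem h _

theorem proj_gen_of_notMem {s : Set (TransformLE n i)} {τ : TransformLE n i} (h : τ ∉ s) (a : A) :
    PiTensorProduct.proj s (gen σ τ a) =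
      algebraMap k _ (σ.transform τ.1 (Coalgebra.counit (R := k) a)) := by
  rw [gen_apply, PiTensorProduct.proj_single_of_notMem h, BaseChange.counit_of]

/-- A ring homomorphism `k[𝒢[i]] → k[𝒢[i + 1]]` that acts on scalars as `θ` and sends the
coordinate functions of index `τ` to those of index `c τ`. The natural inclusion and the
extensions of the basic endomorphisms are of this kind. -/
structure IsStep (θ : k →+* k) (c : TransformLE n i → TransformLE n (i + 1))
    (s : Prolongation σ A i →+* Prolongation σ A (i + 1)) : Prop where
  transform_apply : ∀ τ, σ.transform (c τ).1 = θ.comp (σ.transform τ.1)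
  map_algebraMap : ∀ a, s (algebraMap k _ a) = algebraMap k _ (θ a)
  map_gen : ∀ τ a, s (gen σ τ a) = gen σ (c τ) a

theorem isStep_incl :
    IsStep σ (.id k) TransformLE.incl (incl σ A i : Prolongation σ A i →+* _) where
  transform_apply _ := rfl
  map_algebraMap := AlgHom.commutes (incl σ A i)
  map_gen τ _ := PiTensorProduct.coprodLift_single _ τ _

theorem isStep_endo (j : Fin n) :
    IsStep σ (σ.endo j) (TransformLE.shift j) (endo σ A j i) where
  transform_apply := TransformLE.transform_shift σ j
  map_algebraMap := AlgHom.commutes (R := k)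
    (B := Restrict (σ.endo j) (Prolongation σ A (i + 1))) _
  map_gen τ a := by
    refine (PiTensorProduct.coprodLift_single (R := k)
      (S := Restrict (σ.endo j) (Prolongation σ A (i + 1))) _ τ _).trans ?_
    exact congrArg (single σ A (τ.shift j)) (BaseChange.twist_of _ _ a)

namespace IsStep

variable {σ} {θ : k →+* k} {c : TransformLE n i → TransformLE n (i + 1)}
  {s : Prolongation σ A i →+* Prolongation σ A (i + 1)}

theorem map_proj (hs : IsStep σ θ c s) {S : Set (TransformLE n i)}
    {S' : Set (TransformLE n (i + 1))} (hS : ∀ τ, c τ ∈ S' ↔ τ ∈ S) (x : Prolongation σ A i) :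
    s (PiTensorProduct.proj S x) = PiTensorProduct.proj S' (s x) := by
  refine DFunLike.congr_fun (f := s.comp (PiTensorProduct.proj S).toRingHom)
    (g := (PiTensorProduct.proj S').toRingHom.comp s) (ringHom_ext σ (fun a => ?_)
      fun τ a => ?_) x
  · change s (PiTensorProduct.proj S (algebraMap k _ a)) =
      PiTensorProduct.proj S' (s (algebraMap k _ a))
    rw [AlgHom.commutes, hs.map_algebraMap, AlgHom.commutes]
  · change s (PiTensorProduct.proj S (gen σ τ a)) = PiTensorProduct.proj S' (s (gen σ τ a))
    rw [hs.map_gen]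
    by_cases h : τ ∈ S
    · rw [proj_gen_of_mem σ h, proj_gen_of_mem σ ((hS τ).2 h), hs.map_gen]
    · rw [proj_gen_of_notMem σ h, proj_gen_of_notMem σ fun h' => h ((hS τ).1 h'),
        hs.map_algebraMap, hs.transform_apply]
      rfl

theorem counit_apply (hs : IsStep σ θ c s) (x : Prolongation σ A i) :
    Coalgebra.counit (R := k) (s x) = θ (Coalgebra.counit (R := k) x) := by
  refine DFunLike.congr_fun (f := 
    (Bialgebra.counitAlgHom k (Prolongation σ A (i + 1))).toRingHom.comp s)
    (g := θ.comp (Bialgebra.counitAlgHom k (Prolongation σ A i)).toRingHom)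
    (ringHom_ext σ (fun a => ?_) fun τ a => ?_) x
  · change Coalgebra.counit (R := k) (s (algebraMap k (Prolongation σ A i) a)) =
      θ (Coalgebra.counit (R := k) (algebraMap k (Prolongation σ A i) a))
    rw [hs.map_algebraMap, Bialgebra.counit_algebraMap, Bialgebra.counit_algebraMap]
  · change Coalgebra.counit (R := k) (s (gen σ τ a)) = θ (Coalgebra.counit (R := k) (gen σ τ a))
    rw [hs.map_gen, counit_gen, counit_gen, hs.transform_apply]
    rfl

/-- The point of `𝒢[i]` obtained from a point of `𝒢[i + 1]` by composition with a step. Its values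
lie in the `θ`-twisted algebra. -/
def pullback (hs : IsStep σ θ c s) {E : Type*} [CommRing E] [Algebra k E]
    (f : WithConv (Prolongation σ A (i + 1) →ₐ[k] E)) :
    WithConv (Prolongation σ A i →ₐ[k] Restrict θ E) :=
  toConv
    { toRingHom := f.ofConv.toRingHom.comp s
      commutes' := fun a => by
        exact (congrArg f.ofConv (hs.map_algebraMap a)).trans (AlgHom.commutes f.ofConv (θ a)) }

variable {E : Type*} [CommRing E] [Algebra k E]

theorem pullback_apply (hs : IsStep σ θ c s) (f : WithConv (Prolongation σ A (i + 1) →ₐ[k] E))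
    (x : Prolongation σ A i) : hs.pullback f x = f (s x) := rfl

theorem pullback_mul (hs : IsStep σ θ c s)
    (f g : WithConv (Prolongation σ A (i + 1) →ₐ[k] E)) :
    hs.pullback (f * g) = hs.pullback f * hs.pullback g := by
  have h : ((hs.pullback (f * g)).ofConv : Prolongation σ A i →+* Restrict θ E) =
      (hs.pullback f * hs.pullback g).ofConv := by
    refine ringHom_ext σ (fun a => ?_) fun τ a => ?_
    · exact (AlgHom.commutes (hs.pullback (f * g)).ofConv a).trans
        (AlgHom.commutes (hs.pullback f * hs.pullback g).ofConv a).symm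
    · have r := Coalgebra.Repr.arbitrary k a
      refine Eq.trans ?_ (convMul_gen σ (hs.pullback f) (hs.pullback g) τ a r).symm
      refine (congrArg (f * g).ofConv (hs.map_gen τ a)).trans ?_
      rw [convMul_gen σ f g (c τ) a r]
      refine Finset.sum_congr rfl fun j _ => ?_
      rw [pullback_apply, pullback_apply, hs.map_gen, hs.map_gen]
      rfl
  exact ofConv_injective (AlgHom.coe_ringHom_injective h)

theorem pullback_one (hs : IsStep σ θ c s) :
    hs.pullback (1 : WithConv (Prolongation σ A (i + 1) →ₐ[k] E)) = 1 := by
  refine ofConv_injective (AlgHom.ext fun x => ?_)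
  exact congrArg (algebraMap k E) (hs.counit_apply x)

theorem pullback_pointInv (hs : IsStep σ θ c s)
    (f : WithConv (Prolongation σ A (i + 1) →ₐ[k] E)) :
    hs.pullback (HopfAlgebra.pointInv f) = HopfAlgebra.pointInv (hs.pullback f) := by
  refine left_inv_eq_right_inv (a := hs.pullback f) ?_ (HopfAlgebra.mul_pointInv _)
  rw [← pullback_mul, HopfAlgebra.pointInv_mul, pullback_one]

theorem convMul_map_eq_zero (hs : IsStep σ θ c s) {I : Ideal (Prolongation σ A i)}
    (hI : I.IsHopfIdeal k) {f g : WithConv (Prolongation σ A (i + 1) →ₐ[k] E)}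
    (hf : ∀ x ∈ I, f (s x) = 0) (hg : ∀ x ∈ I, g (s x) = 0) : ∀ x ∈ I, (f * g) (s x) = 0 := by
  intro x hx
  have h := hI.convMul_apply_eq_zero (f := hs.pullback f) (g := hs.pullback g) hf hg x hx
  rwa [← pullback_mul] at h

theorem pointInv_map_eq_zero (hs : IsStep σ θ c s) {I : Ideal (Prolongation σ A i)}
    (hI : I.IsHopfIdeal k) {f : WithConv (Prolongation σ A (i + 1) →ₐ[k] E)}
    (hf : ∀ x ∈ I, f (s x) = 0) : ∀ x ∈ I, HopfAlgebra.pointInv f (s x) = 0 := by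
  intro x hx
  have h := hI.pointInv_apply_eq_zero (f := hs.pullback f) hf x hx
  rwa [← pullback_pointInv] at h

end IsStep

/-- An ideal generated by images of Hopf ideals under steps is a Hopf ideal. -/
theorem isHopfIdeal_span {I : Ideal (Prolongation σ A i)} (hI : I.IsHopfIdeal k)
    (S : Set (Prolongation σ A (i + 1)))
    (hS : ∀ x ∈ S, ∃ θ c s, IsStep σ θ c s ∧ (∃ y ∈ I, s y = x) ∧ ∀ y ∈ I, s y ∈ S) :
    (Ideal.span S).IsHopfIdeal k := by
  have hq {s : Prolongation σ A i →+* Prolongation σ A (i + 1)} (hsS : ∀ y ∈ I, s y ∈ S) :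
      ∀ y ∈ I, Ideal.Quotient.mk (Ideal.span S) (s y) = 0 := fun y hy =>
    Ideal.Quotient.eq_zero_iff_mem.2 (Ideal.subset_span (hsS y hy))
  refine Ideal.isHopfIdeal_span S (fun x hx => ?_) (fun x hx => ?_) (fun x hx => ?_)
  · obtain ⟨θ, c, s, hs, ⟨y, hy, rfl⟩, -⟩ := hS x hx
    rw [hs.counit_apply, hI.counit_eq_zero hy, map_zero]
  · obtain ⟨θ, c, s, hs, ⟨y, hy, rfl⟩, hsS⟩ := hS x hx
    exact hs.convMul_map_eq_zero hI
      (fun z hz => (congrArg (· ⊗ₜ[k] _) (hq hsS z hz)).trans (TensorProduct.zero_tmul _ _))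
      (fun z hz => (congrArg (_ ⊗ₜ[k] ·) (hq hsS z hz)).trans (TensorProduct.tmul_zero _ _)) y hy
  · obtain ⟨θ, c, s, hs, ⟨y, hy, rfl⟩, hsS⟩ := hS x hx
    exact hs.pointInv_map_eq_zero hI (hq hsS) y hy

end Prolongation

/-! ### Leading exponents -/

/-- An ideal of a polynomial ring over a field is determined, inside a larger one, by its leading
exponents. -/
theorem MonomialOrder.ideal_le_of_degree {σ K : Type*} [Field K] (m : MonomialOrder σ)
    {J J' : Ideal (MvPolynomial σ K)} (hle : J ≤ J')
    (h : ∀ p ∈ J', p ≠ 0 → ∃ q ∈ J, q ≠ 0 ∧ m.degree q = m.degree p) : J' ≤ J := by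
  intro p
  induction hd : m.toSyn (m.degree p) using WellFoundedLT.induction generalizing p with
  | ind d ih =>
    intro hp
    rcases eq_or_ne p 0 with rfl | hp0
    · exact J.zero_mem
    obtain ⟨q, hq, hq0, hdeg⟩ := h p hp hp0
    let c := m.leadingCoeff p / m.leadingCoeff q
    have hlc : m.leadingCoeff q ≠ 0 := m.leadingCoeff_ne_zero_iff.2 hq0
    have hcq : c • q ∈ J := by
      rw [MvPolynomial.smul_eq_C_mul]
      exact J.mul_mem_left _ hq
    have hmem : p - c • q ∈ J := by
      rcases eq_or_ne (p - c • q) 0 with h0 | h0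
      · rw [h0]; exact J.zero_mem
      refine ih _ ?_ rfl (J'.sub_mem hp (hle hcq))
      rw [← hd]
      refine lt_of_le_of_ne ?_ fun heq => ?_
      · refine m.degree_sub_le.trans (sup_le le_rfl ?_)
        exact m.degree_smul_le.trans_eq (by rw [hdeg])
      · have h1 := m.leadingCoeff_ne_zero_iff.2 h0
        rw [MonomialOrder.leadingCoeff, m.toSyn.injective heq, MvPolynomial.coeff_sub,
          MvPolynomial.coeff_smul] at h1
        refine h1 ?_
        change m.leadingCoeff p - c • _ = 0
        rw [← hdeg]
        change m.leadingCoeff p - c * m.leadingCoeff q = 0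
        rw [div_mul_cancel₀ _ hlc, sub_self]
    have := J.add_mem hmem hcq
    rwa [sub_add_cancel] at this

theorem MonomialOrder.degree_map {σ K L : Type*} [Field K] [Field L] (m : MonomialOrder σ)
    (θ : K →+* L) (p : MvPolynomial σ K) : m.degree (MvPolynomial.map θ p) = m.degree p := by
  rw [MonomialOrder.degree, MonomialOrder.degree,
    MvPolynomial.support_map_of_injective _ θ.injective]

theorem MvPolynomial.map_ne_zero_of_ne_zero {K L ι : Type*} [Field K] [Field L] (θ : K →+* L)
    {p : MvPolynomial ι K} (hp : p ≠ 0) : MvPolynomial.map θ p ≠ 0 :=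
  (map_ne_zero_iff _ (MvPolynomial.map_injective θ θ.injective)).2 hp

/-- Dickson's lemma for a graded family of upward closed sets of exponents. If the sets `L i τ`, for
`τ` of order at most `i`, grow when `i` increases, when `τ` is shifted, and contain all multiples of
their elements, then from some `i` on each element of `L (i + 1) τ` comes from a predecessor. -/
theorem exists_forall_mem_of_succ {n : ℕ} {M : Type*} [AddCommMonoid M] [PartialOrder M]
    [CanonicallyOrderedAdd M] [WellQuasiOrderedLE M] (L : ℕ → (Fin n → ℕ) → Set M)
    (hle : ∀ i τ α, α ∈ L i τ → ∑ j, τ j ≤ i)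
    (hsucc : ∀ i τ α, α ∈ L i τ → α ∈ L (i + 1) τ)
    (hshift : ∀ i τ α j, α ∈ L i τ → α ∈ L (i + 1) (Pi.single j 1 + τ))
    (hadd : ∀ i τ α β, α ∈ L i τ → α + β ∈ L i τ) :
    ∃ m, ∀ i ≥ m, ∀ τ, ∀ α ∈ L (i + 1) τ,
      α ∈ L i τ ∨ ∃ j ν, τ = Pi.single j 1 + ν ∧ α ∈ L i ν := by
  have hsum (j : Fin n) (τ : Fin n → ℕ) :
      ∑ l, (Pi.single j 1 + τ : Fin n → ℕ) l = ∑ l, τ l + 1 := by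
    simp only [Pi.add_apply, Finset.sum_add_distrib, Finset.sum_pi_single', Finset.mem_univ,
      if_true, add_comm]
  have hsplit (ρ : Fin n → ℕ) (h : ∑ j, ρ j ≠ 0) :
      ∃ (j : Fin n) (ρ' : Fin n → ℕ), ρ = Pi.single j 1 + ρ' := by
    obtain ⟨j, -, hj⟩ := Finset.exists_ne_zero_of_sum_ne_zero h
    refine ⟨j, exists_add_of_le fun l => ?_⟩
    rcases eq_or_ne l j with rfl | hl
    · rw [Pi.single_eq_same]
      exact Nat.one_le_iff_ne_zero.2 hj
    · rw [Pi.single_eq_of_ne hl]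
      exact Nat.zero_le _
  have hsucc' (d i τ α) (h : α ∈ L i τ) : α ∈ L (i + d) τ := by
    induction d with
    | zero => exact h
    | succ d ih => exact hsucc _ _ _ ih
  have hshift' (ρ : Fin n → ℕ) (i τ α) (h : α ∈ L i τ) : α ∈ L (i + ∑ j, ρ j) (ρ + τ) := by
    induction hd : ∑ j, ρ j generalizing ρ with
    | zero =>
      have : ρ = 0 := funext fun j => (Finset.sum_eq_zero_iff.1 hd) j (Finset.mem_univ j)
      rwa [this, zero_add]
    | succ d ih =>
      obtain ⟨j, ρ', rfl⟩ := hsplit ρ (by omega)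
      rw [hsum] at hd
      rw [add_assoc]
      exact hshift _ _ _ _ (ih ρ' (by omega))
  -- in the coordinate `i - ∑ j, τ j` instead of `i`, both steps increase exactly one coordinate
  let E : Set (ℕ × (Fin n → ℕ) × M) := {x | x.2.2 ∈ L (x.1 + ∑ j, x.2.1 j) x.2.1}
  have hfin : {x | Minimal (· ∈ E) x}.Finite :=
    WellQuasiOrderedLE.finite_of_isAntichain (setOfPred_minimal_antichain (· ∈ E))
  obtain ⟨m, hm⟩ := (hfin.image fun x => x.1 + ∑ j, x.2.1 j).bddAbove
  refine ⟨m, fun i hi τ α hα => ?_⟩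
  have hτ := hle _ _ _ hα
  have hE : (i + 1 - ∑ j, τ j, τ, α) ∈ E := by
    change α ∈ L (i + 1 - ∑ j, τ j + ∑ j, τ j) τ
    rwa [Nat.sub_add_cancel hτ]
  obtain ⟨⟨s, ν, β⟩, hle', hmin⟩ := exists_minimal_le_of_wellFoundedLT (· ∈ E) _ hE
  obtain ⟨hs, hν, hβ⟩ : s ≤ i + 1 - ∑ j, τ j ∧ ν ≤ τ ∧ β ≤ α := hle'
  have hbound : s + ∑ j, ν j ≤ m := hm ⟨_, hmin, rfl⟩
  obtain ⟨γ, rfl⟩ := exists_add_of_le hβ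
  have hmem : β + γ ∈ L (s + ∑ j, ν j) ν := hadd _ _ _ _ hmin.1
  obtain ⟨ρ, rfl⟩ := exists_add_of_le hν
  have hsum' : ∑ j, (ν + ρ) j = ∑ j, ν j + ∑ j, ρ j := Finset.sum_add_distrib
  rw [hsum'] at hs hτ
  by_cases hlt : s + ∑ j, ν j + ∑ j, ρ j ≤ i
  · left
    have h1 := hsucc' (i - (s + ∑ j, ν j + ∑ j, ρ j)) _ _ _ (hshift' ρ _ _ _ hmem)
    rwa [Nat.add_sub_cancel' hlt, add_comm ρ] at h1
  · right
    obtain ⟨j, ρ', rfl⟩ := hsplit ρ (by omega)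
    refine ⟨j, ρ' + ν, by rw [add_comm ν, add_assoc], ?_⟩
    rw [hsum] at hlt hs hτ
    have h1 := hshift' ρ' _ _ _ hmem
    rwa [show s + ∑ j, ν j + ∑ j, ρ' j = i by omega] at h1

/-! ### The kernels of a closed subgroup of a prolongation -/

namespace Prolongation

variable {n : ℕ} {k : Type*} [Field k] (σ : DifferenceStructure n k)
  {A : Type*} [CommRing A] [HopfAlgebra k A] {i r : ℕ}

/-- The initial segment of indices below `τ` in the lexicographic order. The order is compatible
with the multiplication of transforms. -/
def segment (τ : TransformLE n i) : Set (TransformLE n i) := {ν | toLex ν.1 ≤ toLex τ.1}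

/-- The embedding of the factor of index `τ`, on the polynomial presentation of that factor
induced by generators `a` of the coordinate algebra. -/
def polyHom (a : Fin r → A) (τ : TransformLE n i) :
    MvPolynomial (Fin r) k →ₐ[k] Prolongation σ A i :=
  MvPolynomial.aeval fun l => gen σ τ (a l)

theorem gen_aeval (a : Fin r → A) (τ : TransformLE n i) (p : MvPolynomial (Fin r) k) :
    gen σ τ (MvPolynomial.aeval a p) =
      polyHom σ a τ (MvPolynomial.map (σ.transform τ.1) p) := by
  refine DFunLike.congr_fun (f := (gen σ τ).comp (MvPolynomial.aeval a).toRingHom)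
    (g := (polyHom σ a τ).toRingHom.comp (MvPolynomial.map (σ.transform τ.1)))
    (MvPolynomial.ringHom_ext (fun c => ?_) fun l => ?_) p
  · change gen σ τ (MvPolynomial.aeval a (MvPolynomial.C c)) =
      polyHom σ a τ (MvPolynomial.map (σ.transform τ.1) (MvPolynomial.C c))
    rw [MvPolynomial.map_C, MvPolynomial.aeval_C, gen_algebraMap, polyHom, MvPolynomial.aeval_C]
  · change gen σ τ (MvPolynomial.aeval a (MvPolynomial.X l)) =
      polyHom σ a τ (MvPolynomial.map (σ.transform τ.1) (MvPolynomial.X l))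
    rw [MvPolynomial.map_X, MvPolynomial.aeval_X, polyHom, MvPolynomial.aeval_X]

theorem exists_polyHom_eq_proj {a : Fin r → A}
    (ha : Function.Surjective (MvPolynomial.aeval a : MvPolynomial (Fin r) k →ₐ[k] A))
    (τ : TransformLE n i) (x : Prolongation σ A i) :
    ∃ p, polyHom σ a τ p = PiTensorProduct.proj {τ} x := by
  refine mem_of_gen_mem σ ((polyHom σ a τ).range.comap (PiTensorProduct.proj {τ}))
    (fun ν b => ?_) x
  rw [Subalgebra.mem_comap]
  by_cases h : ν = τ
  · subst h
    obtain ⟨p, rfl⟩ := ha b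
    rw [proj_gen_of_mem σ (Set.mem_singleton ν), gen_aeval]
    exact ⟨_, rfl⟩
  · rw [proj_gen_of_notMem σ (Set.notMem_singleton_iff.2 h)]
    exact Subalgebra.algebraMap_mem _ _

theorem proj_polyHom (a : Fin r → A) {τ : TransformLE n i} {s : Set (TransformLE n i)}
    (hτ : τ ∈ s) (p : MvPolynomial (Fin r) k) :
    PiTensorProduct.proj s (polyHom σ a τ p) = polyHom σ a τ p := by
  refine DFunLike.congr_fun (f := (PiTensorProduct.proj s).comp (polyHom σ a τ))
    (MvPolynomial.algHom_ext fun l => ?_) p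
  change PiTensorProduct.proj s (polyHom σ a τ (MvPolynomial.X l)) =
    polyHom σ a τ (MvPolynomial.X l)
  rw [polyHom, MvPolynomial.aeval_X, proj_gen_of_mem σ hτ]

/-- The ideal, in the polynomial presentation of the factor of index `τ`, of the kernel of the
projection from the image of the subgroup `I` in the factors of index at most `τ` to its image in
the factors of smaller index. -/
def kernelIdeal (a : Fin r → A) (I : Ideal (Prolongation σ A i)) (τ : TransformLE n i) :
    Ideal (MvPolynomial (Fin r) k) where
  carrier := {p | ∃ f ∈ I, PiTensorProduct.proj (segment τ) f = f ∧
    PiTensorProduct.proj {τ} f = polyHom σ a τ p}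
  zero_mem' := ⟨0, I.zero_mem, map_zero _, by rw [map_zero, map_zero]⟩
  add_mem' := by
    rintro p q ⟨f, hf, h1, h2⟩ ⟨g, hg, h3, h4⟩
    exact ⟨f + g, I.add_mem hf hg, by rw [map_add, h1, h3], by rw [map_add, h2, h4, map_add]⟩
  smul_mem' := by
    rintro q p ⟨f, hf, h1, h2⟩
    refine ⟨polyHom σ a τ q * f, I.mul_mem_left _ hf, ?_, ?_⟩
    · rw [map_mul, h1, proj_polyHom σ a (show τ ∈ segment τ from le_refl (toLex τ.1))]
    · rw [map_mul, h2, proj_polyHom σ a (Set.mem_singleton τ), smul_eq_mul, map_mul]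

theorem kernelIdeal_mono (a : Fin r → A) {I I' : Ideal (Prolongation σ A i)} (h : I ≤ I')
    (τ : TransformLE n i) : kernelIdeal σ a I τ ≤ kernelIdeal σ a I' τ := by
  rintro p ⟨f, hf, h1, h2⟩
  exact ⟨f, h hf, h1, h2⟩

variable {σ} in
theorem IsStep.map_mem_kernelIdeal {θ : k →+* k} {c : TransformLE n i → TransformLE n (i + 1)}
    {s : Prolongation σ A i →+* Prolongation σ A (i + 1)} (hs : IsStep σ θ c s)
    (hc : c.Injective) (hmono : ∀ ν τ, toLex (c ν).1 ≤ toLex (c τ).1 ↔ toLex ν.1 ≤ toLex τ.1)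
    (a : Fin r → A) {I : Ideal (Prolongation σ A i)} {I' : Ideal (Prolongation σ A (i + 1))}
    (hI : ∀ f ∈ I, s f ∈ I') {τ : TransformLE n i} {p : MvPolynomial (Fin r) k}
    (hp : p ∈ kernelIdeal σ a I τ) : MvPolynomial.map θ p ∈ kernelIdeal σ a I' (c τ) := by
  obtain ⟨f, hf, h1, h2⟩ := hp
  refine ⟨s f, hI f hf, ?_, ?_⟩
  · rw [← hs.map_proj (S := segment τ) (fun ν => hmono ν τ), h1]
  · rw [← hs.map_proj (S := {τ}) (fun ν => hc.eq_iff), h2]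
    refine DFunLike.congr_fun (f := s.comp (polyHom σ a τ).toRingHom)
      (g := (polyHom σ a (c τ)).toRingHom.comp (MvPolynomial.map θ))
      (MvPolynomial.ringHom_ext (fun b => ?_) fun l => ?_) p
    · change s (polyHom σ a τ (MvPolynomial.C b)) =
        polyHom σ a (c τ) (MvPolynomial.map θ (MvPolynomial.C b))
      rw [MvPolynomial.map_C, polyHom, polyHom, MvPolynomial.aeval_C, MvPolynomial.aeval_C,
        hs.map_algebraMap]
    · change s (polyHom σ a τ (MvPolynomial.X l)) =
        polyHom σ a (c τ) (MvPolynomial.map θ (MvPolynomial.X l))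
      rw [MvPolynomial.map_X, polyHom, polyHom, MvPolynomial.aeval_X, MvPolynomial.aeval_X,
        hs.map_gen]

end Prolongation

/-! ### Stabilisation of the kernels -/

namespace Prolongation

variable {n : ℕ} {k : Type*} [Field k] (σ : DifferenceStructure n k)
  {A : Type*} [CommRing A] [HopfAlgebra k A] {r : ℕ}

/-- The leading exponents of the kernel of index `τ` of the `i`-th group of a sequence. It is empty
if the order of `τ` exceeds `i`. -/
def leadExponents (a : Fin r → A) (I : ∀ i, Ideal (Prolongation σ A i)) (i : ℕ)
    (τ : Fin n → ℕ) : Set (Fin r →₀ ℕ) :=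
  {α | ∃ h : ∑ j, τ j ≤ i, ∃ p ∈ kernelIdeal σ a (I i) ⟨τ, h⟩,
    p ≠ 0 ∧ MonomialOrder.lex.degree p = α}

theorem add_mem_leadExponents (a : Fin r → A) (I : ∀ i, Ideal (Prolongation σ A i)) {i : ℕ}
    {τ : Fin n → ℕ} {α : Fin r →₀ ℕ} (h : α ∈ leadExponents σ a I i τ) (β : Fin r →₀ ℕ) :
    α + β ∈ leadExponents σ a I i τ := by
  obtain ⟨h, p, hp, hp0, rfl⟩ := h
  have hβ : MvPolynomial.monomial β (1 : k) ≠ 0 := by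
    rw [Ne, MvPolynomial.monomial_eq_zero]
    exact one_ne_zero
  refine ⟨h, p * MvPolynomial.monomial β 1, Ideal.mul_mem_right _ _ hp, mul_ne_zero hp0 hβ, ?_⟩
  classical
  rw [MonomialOrder.degree_mul hp0 hβ, MonomialOrder.degree_monomial, if_neg one_ne_zero]

theorem toLex_incl_le_iff {i : ℕ} (ν τ : TransformLE n i) :
    toLex ν.incl.1 ≤ toLex τ.incl.1 ↔ toLex ν.1 ≤ toLex τ.1 := Iff.rfl

theorem toLex_shift_le_iff {i : ℕ} (j : Fin n) (ν τ : TransformLE n i) :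
    toLex (ν.shift j).1 ≤ toLex (τ.shift j).1 ↔ toLex ν.1 ≤ toLex τ.1 := by
  change toLex (Pi.single j 1) + toLex ν.1 ≤ toLex (Pi.single j 1) + toLex τ.1 ↔ _
  exact add_le_add_iff_left _

theorem incl_injective {i : ℕ} : (TransformLE.incl : TransformLE n i → _).Injective :=
  fun _ _ h => Subtype.ext (congrArg (fun τ => τ.1) h)

theorem shift_injective {i : ℕ} (j : Fin n) :
    (TransformLE.shift j : TransformLE n i → _).Injective :=
  fun _ _ h => Subtype.ext (add_left_cancel (congrArg (fun τ => τ.1) h))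

theorem map_incl_mem_kernelIdeal (a : Fin r → A) {i : ℕ} {I : Ideal (Prolongation σ A i)}
    {J : Ideal (Prolongation σ A (i + 1))} (hJ : ∀ f ∈ I, incl σ A i f ∈ J) {τ : TransformLE n i}
    {p : MvPolynomial (Fin r) k} (hp : p ∈ kernelIdeal σ a I τ) :
    MvPolynomial.map (.id k) p ∈ kernelIdeal σ a J τ.incl :=
  (isStep_incl σ).map_mem_kernelIdeal incl_injective toLex_incl_le_iff a hJ hp

theorem map_endo_mem_kernelIdeal (a : Fin r → A) {i : ℕ} {I : Ideal (Prolongation σ A i)}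
    {J : Ideal (Prolongation σ A (i + 1))} (j : Fin n) (hJ : ∀ f ∈ I, endo σ A j i f ∈ J)
    {τ : TransformLE n i} {p : MvPolynomial (Fin r) k} (hp : p ∈ kernelIdeal σ a I τ) :
    MvPolynomial.map (σ.endo j) p ∈ kernelIdeal σ a J (τ.shift j) :=
  (isStep_endo σ j).map_mem_kernelIdeal (shift_injective j) (toLex_shift_le_iff j) a hJ hp

/-- From some `i` on, the leading exponents of the kernels of `G[i + 1]` all come from `G[i]`. -/
theorem exists_leadExponents_stable (a : Fin r → A) (G : GeneralisedGroup σ A) :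
    ∃ m, ∀ i ≥ m, ∀ τ, ∀ α ∈ leadExponents σ a G.ideal (i + 1) τ,
      α ∈ leadExponents σ a G.ideal i τ ∨
        ∃ j ν, τ = Pi.single j 1 + ν ∧ α ∈ leadExponents σ a G.ideal i ν := by
  refine exists_forall_mem_of_succ (leadExponents σ a G.ideal) (fun _ _ _ h => h.1) ?_ ?_
    (fun _ _ _ β h => add_mem_leadExponents σ a _ h β)
  · rintro i τ _ ⟨h, p, hp, hp0, rfl⟩
    have h1 := map_incl_mem_kernelIdeal σ a (τ := ⟨τ, h⟩) (G.incl_mem i) hp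
    exact ⟨_, MvPolynomial.map (.id k) p, h1, MvPolynomial.map_ne_zero_of_ne_zero _ hp0,
      MonomialOrder.degree_map _ _ _⟩
  · rintro i τ _ j ⟨h, p, hp, hp0, rfl⟩
    have h1 := map_endo_mem_kernelIdeal σ a (τ := ⟨τ, h⟩) j (G.endo_mem i j) hp
    exact ⟨_, MvPolynomial.map (σ.endo j) p, h1, MvPolynomial.map_ne_zero_of_ne_zero _ hp0,
      MonomialOrder.degree_map _ _ _⟩

/-- A closed subgroup of `𝒢[i]` is determined, inside a larger one, by its kernels. -/
theorem eq_of_kernelIdeal_le [Algebra.FiniteType k A] {a : Fin r → A}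
    (ha : Function.Surjective (MvPolynomial.aeval a : MvPolynomial (Fin r) k →ₐ[k] A)) {i : ℕ}
    {I I' : Ideal (Prolongation σ A i)} (hI : I.IsHopfIdeal k) (hI' : I'.IsHopfIdeal k)
    (hle : I ≤ I') (h : ∀ τ, kernelIdeal σ a I' τ ≤ kernelIdeal σ a I τ) : I = I' := by
  have : IsNoetherianRing (Prolongation σ A i) := Algebra.FiniteType.isNoetherianRing k _
  refine PiTensorProduct.eq_of_proj_le (fun τ : TransformLE n i => toLex τ.1)
    (fun _ _ h => Subtype.ext (toLex.injective h)) hI hI' hle fun τ f hf hfτ => ?_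
  obtain ⟨p, hp⟩ := exists_polyHom_eq_proj σ ha τ f
  obtain ⟨g, hg, h1, h2⟩ := h τ ⟨f, hf, hfτ, hp.symm⟩
  exact ⟨g, hg, h1, h2.trans hp⟩

end Prolongation

end

theorem mainTheorem1 {n : ℕ} {k : Type*} [Field k] (σ : DifferenceStructure n k)
    (A : Type*) [CommRing A] [HopfAlgebra k A] [Algebra.FiniteType k A]
    (G : GeneralisedGroup σ A) :
    ∃ m : ℕ, ∀ i ≥ m,
      G.ideal (i + 1) =
        Ideal.span
          (Prolongation.incl σ A i '' (G.ideal i) ∪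
            ⋃ j : Fin n, Prolongation.endo σ A j i '' (G.ideal i)) := by
  obtain ⟨r, φ, hφ⟩ := Algebra.FiniteType.iff_quotient_mvPolynomial''.1
    (inferInstance : Algebra.FiniteType k A)
  obtain ⟨a, rfl⟩ : ∃ a : Fin r → A, φ = MvPolynomial.aeval a :=
    ⟨fun l => φ (MvPolynomial.X l), MvPolynomial.aeval_unique φ⟩
  obtain ⟨m, hm⟩ := Prolongation.exists_leadExponents_stable σ a G
  refine ⟨m, fun i hi => ?_⟩
  set S : Set (Prolongation σ A (i + 1)) := Prolongation.incl σ A i '' (G.ideal i) ∪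
    ⋃ j : Fin n, Prolongation.endo σ A j i '' (G.ideal i)
  have hSincl : ∀ f ∈ G.ideal i, Prolongation.incl σ A i f ∈ S := fun f hf => Or.inl ⟨f, hf, rfl⟩
  have hSendo (j : Fin n) : ∀ f ∈ G.ideal i, Prolongation.endo σ A j i f ∈ S := fun f hf =>
    Or.inr (Set.mem_iUnion.2 ⟨j, f, hf, rfl⟩)
  have hHopf : (Ideal.span S).IsHopfIdeal k := by
    refine Prolongation.isHopfIdeal_span σ (G.isHopfIdeal i) S fun x hx => ?_
    rcases hx with ⟨f, hf, rfl⟩ | hx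
    · exact ⟨_, _, _, Prolongation.isStep_incl σ, ⟨f, hf, rfl⟩, hSincl⟩
    · obtain ⟨j, f, hf, rfl⟩ := Set.mem_iUnion.1 hx
      exact ⟨_, _, _, Prolongation.isStep_endo σ j, ⟨f, hf, rfl⟩, hSendo j⟩
  have hle : Ideal.span S ≤ G.ideal (i + 1) := by
    refine Ideal.span_le.2 fun x hx => ?_
    rcases hx with ⟨f, hf, rfl⟩ | hx
    · exact G.incl_mem i f hf
    · obtain ⟨j, f, hf, rfl⟩ := Set.mem_iUnion.1 hx
      exact G.endo_mem i j f hf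
  refine (Prolongation.eq_of_kernelIdeal_le σ hφ hHopf (G.isHopfIdeal (i + 1)) hle
    fun τ => ?_).symm
  refine MonomialOrder.lex.ideal_le_of_degree (Prolongation.kernelIdeal_mono σ a hle τ)
    fun p hp hp0 => ?_
  obtain ⟨τ, hτ⟩ := τ
  rcases hm i hi τ _ ⟨hτ, p, hp, hp0, rfl⟩ with ⟨h, q, hq, hq0, hdeg⟩ |
    ⟨j, ν, rfl, h, q, hq, hq0, hdeg⟩
  · have h1 := Prolongation.map_incl_mem_kernelIdeal σ a (τ := ⟨τ, h⟩)
      (fun f hf => Ideal.subset_span (hSincl f hf)) hq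
    exact ⟨MvPolynomial.map (.id k) q, h1, MvPolynomial.map_ne_zero_of_ne_zero _ hq0,
      (MonomialOrder.degree_map _ _ _).trans hdeg⟩
  · have h1 := Prolongation.map_endo_mem_kernelIdeal σ a (τ := ⟨ν, h⟩) j
      (fun f hf => Ideal.subset_span (hSendo j f hf)) hq
    exact ⟨MvPolynomial.map (σ.endo j) q, h1, MvPolynomial.map_ne_zero_of_ne_zero _ hq0,
      (MonomialOrder.degree_map _ _ _).trans hdeg⟩
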